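/- **Setting.** Let $N:\mathbb{R}\to(0,\infty)$ and $\alpha:\mathbb{R}\to\mathbb{R}$ be smooth, and for $n\in\mathbb{Z}$ put $R_n(x)=[n-\alpha(x)]N(x)$. Let $\mathcal{H}=L^2([0,2\pi]\times\mathbb{R},d\omega\,dx)$, and let $U(\lambda)=\exp(i\lambda\hat\phi)$, $\lambda\in\mathbb{R}$, be the unitary group generated by the self-adjoint operator $\hat\phi=-iN(x)\partial_\omega$ with boundary condition $\psi(0,x)=e^{2\pi i\alpha(x)}\psi(2\pi,x)$; explicitly, $U(\lambda)$ translates $\omega$ by $\lambda N(x)$ modulo $2\pi$, with a factor $e^{-2\pi i\alpha(x)}$ for each passage through $\omega=2\pi$. Writing $\psi(\omega,x)=(2\pi)^{-1/2}\sum_{n\in\mathbb{Z}}e^{i[n-\alpha(x)]\omega}\psi_n(x)$, one has $(U(\lambda)\psi)_n=e^{iR_n\lambda}\psi_n$. Let $\Phi\subset\mathcal{H}$ be the dense subspace of those $\psi$ for which only finitely many $\psi_n$ are nonzero and each is smooth with compact support, and let $\Phi^*$ be its algebraic dual. The set $\mathcal{A}_{\mathrm{obs}}$ of observables consists of the (possibly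 unbounded, densely defined) operators $A$ on $\mathcal{H}$ such that the domains of $A$ and $A^\dagger$ include $\Phi$, both $A$ and $A^\dagger$ map $\Phi$ to itself, and $A$ commutes with every $U(\lambda)$ on $\Phi$; $A$ acts on $\Phi^*$ by $(AF)[g]=F[A^\dagger g]$. A *rigging map* is an antilinear map $\eta:\Phi\to\Phi^*$ such that for all $f,g\in\Phi$: $\eta(f)[g]=\overline{\eta(g)[f]}$; $\eta(f)[f]\ge0$; $\eta(f)$ is invariant under the dual action of every $U(\lambda)$; and $\eta(Af)[g]=\eta(f)[A^\dagger g]$ for all $A\in\mathcal{A}_{\mathrm{obs}}$. **Assumptions.** (a) For each $n$ the stationary point set of $R_n$ is either empty or the union of at most countably many isolated points, at most countably many closed intervals and at most two closed half-lines, such that any compact subset of $\mathbb{R}$ contains at most finitely many of the isolated points and at most finitely many of the finite intervals. (b$'$) The set $\{x:\alpha(x)\in\mathbb{Z}\}$ is non-empty, at most countable and without accumulation points, and at each of its points $\alpha$ has a nonvanishing derivative of some order $\ge1$. The *order* of a zero $x$ of $R_n$ (that is, of a solution of $\alpha(x)=n$) is the least $p\ge1$ with $\alpha^{(p)}(x)\ne0$.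 Let $\mathcal{P}$ be the set of orders of the zeros of all the $R_n$, $n\in\mathbb{Z}$. (c) If $p\in\mathcal{P}$, then $\mathcal{P}$ contains no factor of $p$ smaller than $p/2$. **Theorem.** For each odd $p\in\mathcal{P}$ let $$\eta_p(f)[g]=\sum_{(n,x)}\frac{\overline{f_n(x)}\,g_n(x)}{|\alpha^{(p)}(x)N(x)|^{1/p}},$$ where the sum is over all pairs $(n,x)$ such that $x$ is a zero of $R_n$ of order $p$. For each even $p\in\mathcal{P}$ and each $\epsilon\in\{1,-1\}$ such that $\alpha^{(p)}$ has the sign $\epsilon$ at some zero of order $p$, let $\eta_{p\epsilon}(f)[g]$ be the same sum restricted to the zeros of order $p$ at which $\alpha^{(p)}$ has the sign $\epsilon$. For all $f,g\in\Phi$ these sums have only finitely many nonzero terms, and: 1. Each $\eta_p$ and each $\eta_{p\epsilon}$ is a rigging map $\Phi\to\Phi^*$ with nontrivial (nonzero) image. 2. The representation of $\mathcal{A}_{\mathrm{obs}}$ on the image of each $\eta_p$ and $\eta_{p\epsilon}$ is irreducible: the image is mapped to itself by $\mathcal{A}_{\mathrm{obs}}$, and the only linear subspaces of the image that are mapped to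 themselves by $\mathcal{A}_{\mathrm{obs}}$ are $\{0\}$ and the image itself. -/

import Mathlib

open MeasureTheory
open scoped ContDiff LinearPMap

noncomputable section

namespace RAQ

/-- The remaining data of the constrained system: the smooth positive function `N` encoding the
classical rescaling of the constraint, and the smooth function `α` encoding the self-adjoint
extension of the quantum constraint (`2πα(x)` is the phase shift between `ω = 2π` and `ω = 0`). -/
structure ScalingData where
  α : ℝ → ℝ
  N : ℝ → ℝ
  α_smooth : ContDiff ℝ ∞ α
  N_smooth : ContDiff ℝ ∞ N
  N_pos : ∀ x, 0 < N x

/-! ### The auxiliary Hilbert space `L²([0,2π] × ℝ, dω dx)` -/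

/-- Lebesgue measure `dω dx` on `[0,2π] × ℝ`. -/
def auxMeasure : Measure (ℝ × ℝ) :=
  (volume.restrict (Set.Icc (0 : ℝ) (2 * Real.pi))).prod volume

/-- The auxiliary Hilbert space; a point of the base is `(ω, x)`. -/
abbrev Haux : Type := Lp ℂ 2 auxMeasure

/-- Smooth complex functions of compact support on `ℝ`. -/
def testFunctions : Submodule ℂ (ℝ → ℂ) where
  carrier := {ψ | ContDiff ℝ ∞ ψ ∧ HasCompactSupport ψ}
  add_mem' := fun h₁ h₂ => ⟨h₁.1.add h₂.1, h₁.2.add h₂.2⟩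
  zero_mem' := ⟨contDiff_const, HasCompactSupport.zero⟩
  smul_mem' := fun c _ h => ⟨contDiff_const.smul h.1, h.2.smul_left (f := fun _ => c)⟩

variable (S : ScalingData)

/-- `R_n(x) = (n - α(x)) N(x)`. -/
def ScalingData.R (n : ℤ) (x : ℝ) : ℝ := ((n : ℝ) - S.α x) * S.N x

/-- The function `(ω, x) ↦ (2π)^{-1/2} e^{i (n - α(x)) ω} ψ(x)`. -/
def modeFun (n : ℤ) (ψ : ℝ → ℂ) (z : ℝ × ℝ) : ℂ :=
  ((Real.sqrt (2 * Real.pi) : ℝ) : ℂ)⁻¹ *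
    Complex.exp (Complex.I * ((((n : ℝ) - S.α z.2) * z.1 : ℝ) : ℂ)) * ψ z.2

theorem modeFun_continuous (n : ℤ) {ψ : ℝ → ℂ} (hψ : Continuous ψ) :
    Continuous (modeFun S n ψ) := by
  have := S.α_smooth.continuous
  unfold modeFun
  fun_prop

theorem modeFun_memLp (n : ℤ) (ψ : testFunctions) :
    MemLp (modeFun S n ψ.1) 2 auxMeasure := by
  have hc : Continuous ψ.1 := ψ.2.1.continuous
  have h1 : MemLp (fun z : ℝ × ℝ => (1 : ℂ) * ψ.1 z.2) 2 auxMeasure := by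
    have hψ : MemLp ψ.1 2 (volume : Measure ℝ) := hc.memLp_of_hasCompactSupport ψ.2.2
    simpa [Function.comp_def, auxMeasure] using
      hψ.comp_snd (volume.restrict (Set.Icc (0 : ℝ) (2 * Real.pi)))
  refine (h1.const_mul ((Real.sqrt (2 * Real.pi) : ℝ) : ℂ)⁻¹).of_le
    (modeFun_continuous S n hc).aestronglyMeasurable (ae_of_all _ fun z => ?_)
  simp [modeFun, Complex.norm_exp]

/-- The `n`-th mode `(2π)^{-1/2} e^{i (n - α(x)) ω} ψ(x)` as an element of `Haux`. -/
def mode (n : ℤ) : testFunctions →ₗ[ℂ] Haux where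
  toFun ψ := (modeFun_memLp S n ψ).toLp _
  map_add' ψ χ := by
    rw [← MemLp.toLp_add]
    congr 1
    funext z
    simp [modeFun, mul_add]
  map_smul' c ψ := by
    rw [RingHom.id_apply, ← MemLp.toLp_const_smul]
    congr 1
    funext z
    simp [modeFun, mul_left_comm]

/-- Finitely many components `ψ_n ∈ C_c^∞(ℝ)` are sent to the state
`(2π)^{-1/2} ∑ₙ e^{i (n - α(x)) ω} ψ_n(x)`. -/
def synth : (ℤ →₀ testFunctions) →ₗ[ℂ] Haux :=
  Finsupp.lsum ℂ (mode S)

theorem integral_exp_int (k : ℤ) :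
    ∫ u in Set.Icc (0 : ℝ) (2 * Real.pi), Complex.exp (Complex.I * ((k : ℂ) * (u : ℂ)))
      = if k = 0 then (2 * Real.pi : ℂ) else 0 := by
  rw [integral_Icc_eq_integral_Ioc,
    ← intervalIntegral.integral_of_le (by positivity : (0 : ℝ) ≤ 2 * Real.pi)]
  split_ifs with h
  · subst h
    simp
  · have hk : Complex.I * (k : ℂ) ≠ 0 := by simp [h]
    simp_rw [← mul_assoc]
    rw [integral_exp_mul_complex hk]
    have : Complex.exp (Complex.I * (k : ℂ) * ((2 * Real.pi : ℝ) : ℂ)) = 1 := by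
      rw [← Complex.exp_int_mul_two_pi_mul_I k]
      congr 1
      push_cast
      ring
    rw [this]
    simp

theorem inner_mode (m n : ℤ) (ψ χ : testFunctions) :
    inner ℂ (mode S m ψ) (mode S n χ)
      = if m = n then ∫ x, (starRingEnd ℂ) (ψ.1 x) * χ.1 x else 0 := by
  have hpi : (Real.sqrt (2 * Real.pi) : ℂ) * (Real.sqrt (2 * Real.pi) : ℂ) = 2 * Real.pi := by
    rw [← Complex.ofReal_mul, Real.mul_self_sqrt (by positivity)]
    push_cast
    ring
  have hpi0 : (2 * Real.pi : ℂ) ≠ 0 := by simp [Real.pi_ne_zero]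
  rw [L2.inner_def]
  have h1 : (fun z => inner ℂ ((mode S m ψ : Haux) z) ((mode S n χ : Haux) z))
      =ᵐ[auxMeasure] fun z : ℝ × ℝ =>
        ((2 * Real.pi : ℂ)⁻¹ * Complex.exp (Complex.I * (((n - m : ℤ) : ℂ) * (z.1 : ℂ)))) *
          ((starRingEnd ℂ) (ψ.1 z.2) * χ.1 z.2) := by
    filter_upwards [(modeFun_memLp S m ψ).coeFn_toLp, (modeFun_memLp S n χ).coeFn_toLp]
      with z hz1 hz2
    simp only [mode, LinearMap.coe_mk, AddHom.coe_mk]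
    rw [hz1, hz2, RCLike.inner_apply]
    simp only [modeFun, map_mul, map_inv₀, Complex.conj_ofReal, ← Complex.exp_conj,
      Complex.conj_I]
    have he : Complex.exp (Complex.I * (((n - m : ℤ) : ℂ) * (z.1 : ℂ)))
        = Complex.exp (Complex.I * ((((n : ℝ) - S.α z.2) * z.1 : ℝ) : ℂ)) *
          Complex.exp (-Complex.I * ((((m : ℝ) - S.α z.2) * z.1 : ℝ) : ℂ)) := by
      rw [← Complex.exp_add]
      congr 1
      push_cast
      ring
    rw [he, ← hpi, mul_inv]
    ring
  rw [integral_congr_ae h1, auxMeasure,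
    integral_prod_mul
      (fun u : ℝ => (2 * Real.pi : ℂ)⁻¹ *
        Complex.exp (Complex.I * (((n - m : ℤ) : ℂ) * (u : ℂ))))
      (fun x => (starRingEnd ℂ) (ψ.1 x) * χ.1 x),
    integral_const_mul, integral_exp_int]
  by_cases h : m = n
  · rw [if_pos (sub_eq_zero.mpr h.symm), if_pos h, inv_mul_cancel₀ hpi0, one_mul]
  · have : n - m ≠ 0 := sub_ne_zero.mpr (Ne.symm h)
    simp [h, this]

theorem inner_mode_synth (m : ℤ) (ψ : testFunctions) (f : ℤ →₀ testFunctions) :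
    inner ℂ (mode S m ψ) (synth S f) = ∫ x, (starRingEnd ℂ) (ψ.1 x) * (f m).1 x := by
  rw [synth, Finsupp.lsum_apply, Finsupp.sum, inner_sum]
  simp_rw [inner_mode]
  rw [Finset.sum_ite_eq]
  split_ifs with h
  · rfl
  · simp [Finsupp.notMem_support_iff.mp h]

/-- The components of a state are unique. -/
theorem synth_injective : Function.Injective (synth S) := by
  rw [injective_iff_map_eq_zero]
  intro f hf
  ext m x
  have h := inner_mode_synth S m (f m) f
  rw [hf, inner_zero_right] at h
  have hc : Continuous (f m).1 := (f m).2.1.continuous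
  have h2 : ∫ x, ‖(f m).1 x‖ ^ 2 = 0 := by
    have : ∫ x, ((‖(f m).1 x‖ ^ 2 : ℝ) : ℂ) = 0 := by
      rw [h]
      refine integral_congr_ae (ae_of_all _ fun x => ?_)
      simp [Complex.conj_mul']
    have h4 := integral_ofReal (μ := volume) (𝕜 := ℂ) (f := fun x => ‖(f m).1 x‖ ^ 2)
    exact Complex.ofReal_eq_zero.mp (h4.symm.trans this)
  have hcs : HasCompactSupport fun x => ‖(f m).1 x‖ ^ 2 :=
    (f m).2.2.comp_left (g := fun w : ℂ => ‖w‖ ^ 2) (by simp)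
  have hint : Integrable fun x => ‖(f m).1 x‖ ^ 2 :=
    (by fun_prop : Continuous fun x => ‖(f m).1 x‖ ^ 2).integrable_of_hasCompactSupport hcs
  rw [integral_eq_zero_iff_of_nonneg (fun x => by positivity) hint] at h2
  have h3 := (Continuous.ae_eq_iff_eq volume (by fun_prop) continuous_const).mp h2
  have h5 : ‖(f m).1 x‖ ^ 2 = 0 := congrFun h3 x
  simpa using h5

/-- The test space `Φ`: states with finitely many nonzero components, each of them smooth with
compact support. -/
def testSpace : Submodule ℂ Haux := LinearMap.range (synth S)

/-- All components of a test state: `f ↦ (f_n)_n`. -/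
def components : testSpace S ≃ₗ[ℂ] (ℤ →₀ testFunctions) :=
  (LinearEquiv.ofInjective (synth S) (synth_injective S)).symm

/-- The component `f_n : ℝ → ℂ` of `f ∈ Φ`. -/
def comp (f : testSpace S) (n : ℤ) : ℝ → ℂ := (components S f n).1

/-! ### The gauge group `U(t) = exp(i t φ)`, `φ = -i N(x) ∂_ω`

With the boundary condition `ψ(0,x) = e^{2πiα(x)} ψ(2π,x)`, `U(t)` translates `ω` by `t N(x)` modulo
`2π`, with a factor `e^{-2πiα(x)}` for each passage through `ω = 2π`. -/

/-- The number of passages of `ω + t N(x)` through `2π`. -/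
def winding (t : ℝ) (z : ℝ × ℝ) : ℤ := ⌊(z.1 + t * S.N z.2) / (2 * Real.pi)⌋

/-- The translation `(ω, x) ↦ (ω + t N(x) mod 2π, x)`. -/
def flow (t : ℝ) (z : ℝ × ℝ) : ℝ × ℝ :=
  (z.1 + t * S.N z.2 - 2 * Real.pi * (winding S t z : ℝ), z.2)

/-- The phase acquired from the boundary condition. -/
def phase (t : ℝ) (z : ℝ × ℝ) : ℂ :=
  Complex.exp (-(Complex.I * ((2 * Real.pi * S.α z.2 * (winding S t z : ℝ) : ℝ) : ℂ)))

theorem winding_measurable (t : ℝ) : Measurable (winding S t) := by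
  have := S.N_smooth.continuous.measurable
  unfold winding
  fun_prop

theorem flow_measurable (t : ℝ) : Measurable (flow S t) := by
  have := S.N_smooth.continuous.measurable
  have h : Measurable fun z => (winding S t z : ℝ) :=
    (measurable_from_top (f := fun n : ℤ => (n : ℝ))).comp (winding_measurable S t)
  unfold flow
  fun_prop

theorem phase_measurable (t : ℝ) : Measurable (phase S t) := by
  have := S.α_smooth.continuous.measurable
  have h : Measurable fun z => (winding S t z : ℝ) :=
    (measurable_from_top (f := fun n : ℤ => (n : ℝ))).comp (winding_measurable S t)
  unfold phase
  fun_prop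

theorem norm_phase (t : ℝ) (z : ℝ × ℝ) : ‖phase S t z‖ = 1 := by
  simp [phase, Complex.norm_exp]

/-- Rotation of the circle `ℝ / 2πℤ`, read on `[0, 2π]`, preserves Lebesgue measure. -/
theorem rotation_map (c : ℝ) :
    Measure.map (fun u : ℝ => u + c - 2 * Real.pi * (⌊(u + c) / (2 * Real.pi)⌋ : ℝ))
      (volume.restrict (Set.Icc (0 : ℝ) (2 * Real.pi)))
      = volume.restrict (Set.Icc (0 : ℝ) (2 * Real.pi)) := by
  have hp : (0 : ℝ) < 2 * Real.pi := by positivity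
  have : Fact ((0 : ℝ) < 2 * Real.pi) := ⟨hp⟩
  have hmk := AddCircle.measurePreserving_mk (2 * Real.pi) 0
  rw [zero_add, restrict_Ioc_eq_restrict_Icc] at hmk
  let e : AddCircle (2 * Real.pi) → ℝ := fun z => (AddCircle.measurableEquivIco (2 * Real.pi) 0 z).1
  have he : Measurable e := measurable_subtype_coe.comp (MeasurableEquiv.measurable _)
  have hemk : ∀ w : ℝ, e (w : AddCircle (2 * Real.pi))
      = w - 2 * Real.pi * (⌊w / (2 * Real.pi)⌋ : ℝ) := by
    intro w
    have h1 : e (w : AddCircle (2 * Real.pi)) = toIcoMod hp 0 w := rfl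
    rw [h1, toIcoMod_eq_fract_mul, Int.fract]
    field_simp
  have h1 : Measure.map e volume = volume.restrict (Set.Icc (0 : ℝ) (2 * Real.pi)) := by
    rw [← hmk.map_eq, Measure.map_map he hmk.measurable]
    conv_rhs => rw [← Measure.map_id (μ := volume.restrict (Set.Icc (0 : ℝ) (2 * Real.pi)))]
    refine Measure.map_congr ?_
    rw [← restrict_Ico_eq_restrict_Icc]
    filter_upwards [ae_restrict_mem measurableSet_Ico] with w hw
    have : ⌊w / (2 * Real.pi)⌋ = 0 := by
      rw [Int.floor_eq_zero_iff]
      exact ⟨div_nonneg hw.1 hp.le, (div_lt_one hp).mpr hw.2⟩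
    simp [hemk, this]
  have h2 : (fun u : ℝ => u + c - 2 * Real.pi * (⌊(u + c) / (2 * Real.pi)⌋ : ℝ))
      = e ∘ (fun z => z + (c : AddCircle (2 * Real.pi))) ∘
        (fun w : ℝ => (w : AddCircle (2 * Real.pi))) := by
    funext u
    simp only [Function.comp_apply]
    rw [← AddCircle.coe_add, hemk]
  have hrot := measurePreserving_add_right
    (volume : Measure (AddCircle (2 * Real.pi))) (c : AddCircle (2 * Real.pi))
  rw [h2, ← Measure.map_map he (hrot.measurable.comp hmk.measurable),
    (hrot.comp hmk).map_eq, h1]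

theorem flow_measurePreserving (t : ℝ) :
    MeasurePreserving (flow S t) auxMeasure auxMeasure := by
  have hN := S.N_smooth.continuous.measurable
  have hm : Measurable (Function.uncurry fun x u : ℝ => (flow S t (u, x)).1) :=
    (measurable_fst.comp (flow_measurable S t)).comp measurable_swap
  have h := (MeasurePreserving.id (volume : Measure ℝ)).skew_product
    (μc := volume.restrict (Set.Icc (0 : ℝ) (2 * Real.pi)))
    (μd := volume.restrict (Set.Icc (0 : ℝ) (2 * Real.pi))) hm
    (ae_of_all _ fun x => rotation_map (t * S.N x))
  exact (Measure.measurePreserving_swap.comp h).comp Measure.measurePreserving_swap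

theorem gauge_memLp (t : ℝ) (ψ : Haux) :
    MemLp (fun z => phase S t z * ψ (flow S t z)) 2 auxMeasure := by
  have h := (Lp.memLp ψ).comp_measurePreserving (flow_measurePreserving S t)
  refine h.of_le ((phase_measurable S t).aestronglyMeasurable.mul h.1) (ae_of_all _ fun z => ?_)
  simp [norm_phase]

/-- The gauge transformation `U(t)`, as an isometry of the auxiliary Hilbert space:
`(U(t)ψ)(ω, x) = phase · ψ(ω + t N(x) mod 2π, x)`. -/
def gauge (t : ℝ) : Haux →ₗᵢ[ℂ] Haux where
  toFun ψ := (gauge_memLp S t ψ).toLp _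
  map_add' ψ χ := by
    rw [← MemLp.toLp_add]
    refine (MemLp.toLp_eq_toLp_iff _ _).mpr ?_
    have h := (flow_measurePreserving S t).quasiMeasurePreserving.ae (Lp.coeFn_add ψ χ)
    filter_upwards [h] with z hz
    rw [hz]
    simp [mul_add]
  map_smul' c ψ := by
    rw [RingHom.id_apply, ← MemLp.toLp_const_smul]
    refine (MemLp.toLp_eq_toLp_iff _ _).mpr ?_
    have h := (flow_measurePreserving S t).quasiMeasurePreserving.ae (Lp.coeFn_smul c ψ)
    filter_upwards [h] with z hz
    rw [hz]
    simp [mul_left_comm]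
  norm_map' ψ := by
    simp only [LinearMap.coe_mk, AddHom.coe_mk]
    rw [Lp.norm_toLp, Lp.norm_def]
    congr 1
    rw [← eLpNorm_comp_measurePreserving (Lp.aestronglyMeasurable ψ) (flow_measurePreserving S t)]
    exact eLpNorm_congr_norm_ae (ae_of_all _ fun z => by simp [norm_phase])

/-- Multiplication of a test function by `e^{i R_n(x) t}`. -/
def phaseMul (t : ℝ) (n : ℤ) (ψ : testFunctions) : testFunctions :=
  ⟨fun x => Complex.exp (Complex.I * ((S.R n x * t : ℝ) : ℂ)) * ψ.1 x, by
    have h1 := S.α_smooth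
    have h2 := S.N_smooth
    have h3 : ContDiff ℝ ∞ fun x => S.R n x * t := by
      unfold ScalingData.R
      fun_prop
    exact ⟨(contDiff_const.mul (Complex.ofRealCLM.contDiff.comp h3)).cexp.mul ψ.2.1,
      ψ.2.2.mul_left⟩⟩

/-- `(U(t)ψ)_n = e^{i R_n t} ψ_n` on a single mode. -/
theorem gauge_mode (t : ℝ) (n : ℤ) (ψ : testFunctions) :
    gauge S t (mode S n ψ) = mode S n (phaseMul S t n ψ) := by
  change (gauge_memLp S t (mode S n ψ)).toLp _ = (modeFun_memLp S n (phaseMul S t n ψ)).toLp _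
  refine (MemLp.toLp_eq_toLp_iff _ _).mpr ?_
  have h := (flow_measurePreserving S t).quasiMeasurePreserving.ae
    (modeFun_memLp S n ψ).coeFn_toLp
  filter_upwards [h] with z hz
  simp only [mode, LinearMap.coe_mk, AddHom.coe_mk]
  rw [hz]
  simp only [modeFun, phase, flow, phaseMul, ScalingData.R]
  generalize winding S t z = k
  have hexp : Complex.exp (-(Complex.I * ((2 * Real.pi * S.α z.2 * (k : ℝ) : ℝ) : ℂ))) *
      Complex.exp (Complex.I * ((((n : ℝ) - S.α z.2) *
        (z.1 + t * S.N z.2 - 2 * Real.pi * (k : ℝ)) : ℝ) : ℂ))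
      = Complex.exp (Complex.I * ((((n : ℝ) - S.α z.2) * z.1 : ℝ) : ℂ)) *
        Complex.exp (Complex.I * ((((n : ℝ) - S.α z.2) * S.N z.2 * t : ℝ) : ℂ)) := by
    rw [← Complex.exp_add, ← Complex.exp_add, Complex.exp_eq_exp_iff_exists_int]
    refine ⟨-(n * k), ?_⟩
    push_cast
    ring
  calc _ = ((Real.sqrt (2 * Real.pi) : ℝ) : ℂ)⁻¹ *
        (Complex.exp (-(Complex.I * ((2 * Real.pi * S.α z.2 * (k : ℝ) : ℝ) : ℂ))) *
        Complex.exp (Complex.I * ((((n : ℝ) - S.α z.2) *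
        (z.1 + t * S.N z.2 - 2 * Real.pi * (k : ℝ)) : ℝ) : ℂ))) * ψ.1 z.2 := by ring
    _ = _ := by
      rw [hexp]
      ring

/-- `Φ` is invariant under the gauge group. -/
theorem gauge_mem (t : ℝ) {ψ : Haux} (hψ : ψ ∈ testSpace S) : gauge S t ψ ∈ testSpace S := by
  obtain ⟨f, rfl⟩ := hψ
  rw [synth, Finsupp.lsum_apply, Finsupp.sum, map_sum]
  refine Submodule.sum_mem _ fun n _ => ?_
  rw [gauge_mode]
  exact ⟨Finsupp.single n (phaseMul S t n (f n)), by simp [synth]⟩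

/-- The restriction of `U(t)` to `Φ`. -/
def gaugeTest (t : ℝ) : testSpace S →ₗ[ℂ] testSpace S :=
  (gauge S t).toLinearMap.restrict fun _ h => gauge_mem S t h

/-! ### Observables and rigging maps -/

/-- An observable: a densely defined, possibly unbounded operator `A` on the auxiliary Hilbert space
such that the domains of `A` and of its adjoint include `Φ`, both map `Φ` to itself, and `A`
commutes with the gauge group on `Φ`. -/
structure Observable where
  op : Haux →ₗ.[ℂ] Haux
  dense : Dense (op.domain : Set Haux)
  le_domain : testSpace S ≤ op.domain
  le_adjoint_domain : testSpace S ≤ op†.domain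
  maps : ∀ f : testSpace S, op ⟨f, le_domain f.2⟩ ∈ testSpace S
  adjoint_maps : ∀ f : testSpace S, op† ⟨f, le_adjoint_domain f.2⟩ ∈ testSpace S
  commutes : ∀ (t : ℝ) (f : testSpace S),
    op ⟨gaugeTest S t f, le_domain (gaugeTest S t f).2⟩ = gauge S t (op ⟨f, le_domain f.2⟩)

variable {S}

/-- `A` restricted to `Φ`. -/
def Observable.act (A : Observable S) : testSpace S →ₗ[ℂ] testSpace S :=
  (A.op.toFun ∘ₗ Submodule.inclusion A.le_domain).codRestrict _ A.maps

/-- `A†` restricted to `Φ`. -/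
def Observable.adjAct (A : Observable S) : testSpace S →ₗ[ℂ] testSpace S :=
  (A.op†.toFun ∘ₗ Submodule.inclusion A.le_adjoint_domain).codRestrict _ A.adjoint_maps

/-- The action of an observable on the algebraic dual `Φ*`: `(A F)[g] = F[A† g]`. -/
def Observable.dualAct (A : Observable S) :
    Module.Dual ℂ (testSpace S) →ₗ[ℂ] Module.Dual ℂ (testSpace S) :=
  A.adjAct.dualMap

variable (S)

/-- Antilinear maps `Φ → Φ*`. -/
abbrev AntilinearToDual : Type :=
  testSpace S →ₛₗ[starRingEnd ℂ] Module.Dual ℂ (testSpace S)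

variable {S}

/-- The axioms of a rigging map. -/
structure IsRiggingMap (η : AntilinearToDual S) : Prop where
  real : ∀ f g, η f g = starRingEnd ℂ (η g f)
  nonneg : ∀ f, ∃ r : ℝ, 0 ≤ r ∧ η f f = (r : ℂ)
  /-- The dual action of `U(t)` on `F ∈ Φ*` is `g ↦ F[U(-t) g]`. -/
  invariant : ∀ (t : ℝ) (f : testSpace S), (gaugeTest S (-t)).dualMap (η f) = η f
  intertwines : ∀ (A : Observable S) (f g : testSpace S), η (A.act f) g = η f (A.adjAct g)

/-- The observables act irreducibly on the image of `η`: the image is nonzero, it is stable under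
the observables, and its only stable linear subspaces are `0` and itself. -/
structure ActsIrreducibly (η : AntilinearToDual S) : Prop where
  nonzero : LinearMap.range η ≠ ⊥
  stable : ∀ A : Observable S, ∀ F ∈ LinearMap.range η, A.dualAct F ∈ LinearMap.range η
  irreducible : ∀ W : Submodule ℂ (Module.Dual ℂ (testSpace S)), W ≤ LinearMap.range η →
    (∀ A : Observable S, ∀ F ∈ W, A.dualAct F ∈ W) → W = ⊥ ∨ W = LinearMap.range η

/-! ### Conditions on `α` and `N` -/

/-- Shape of a stationary point set: a union of at most countably many isolated points `P`, at most
countably many closed intervals (end points in `J`) and at most two closed half-lines (`H`), only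
finitely many of the points and of the intervals lying in any compact set. All three may be empty. -/
def IsTameSet (T : Set ℝ) : Prop :=
  ∃ (P : Set ℝ) (J : Set (ℝ × ℝ)) (H : Set (Set ℝ)),
    T = P ∪ (⋃ I ∈ J, Set.Icc I.1 I.2) ∪ ⋃₀ H ∧
    P.Countable ∧ (∀ x ∈ P, ∃ V ∈ nhds x, T ∩ V = {x}) ∧
    J.Countable ∧ (∀ I ∈ J, I.1 < I.2) ∧
    H.encard ≤ 2 ∧ (∀ h ∈ H, ∃ a, h = Set.Iic a ∨ h = Set.Ici a) ∧
    ∀ K : Set ℝ, IsCompact K → (P ∩ K).Finite ∧ {I ∈ J | Set.Icc I.1 I.2 ⊆ K}.Finite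

variable (S)

/-- Condition (a), on the stationary points of every `R_n`. -/
def ConditionA : Prop := ∀ n : ℤ, IsTameSet {x | deriv (S.R n) x = 0}

/-- The integer value set of `α`. -/
def integerSet : Set ℝ := {x | ∃ n : ℤ, S.α x = n}

/-- Condition (b′), on the integer values of `α`. -/
def ConditionB' : Prop :=
  (integerSet S).Nonempty ∧ (integerSet S).Countable ∧
  (∀ x : ℝ, ¬ AccPt x (Filter.principal (integerSet S))) ∧
  ∀ x ∈ integerSet S, ∃ k : ℕ, 1 ≤ k ∧ iteratedDeriv k S.α x ≠ 0

/-- The lowest nonvanishing derivative of `α` at `x`, of order at least one, has order `p`. -/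
def HasOrder (p : ℕ) (x : ℝ) : Prop :=
  1 ≤ p ∧ (∀ k, 1 ≤ k → k < p → iteratedDeriv k S.α x = 0) ∧ iteratedDeriv p S.α x ≠ 0

/-- The zeroes `x` of `R_n` of order `p`, for all `n`, as pairs `(n, x)`. -/
def zeros (p : ℕ) : Set (ℤ × ℝ) := {z | S.R z.1 z.2 = 0 ∧ HasOrder S p z.2}

/-- Those zeroes in `zeros S p` at which the `p`-th derivative of `α` has the sign `ε`. -/
def signedZeros (p : ℕ) (ε : SignType) : Set (ℤ × ℝ) :=
  {z ∈ zeros S p | SignType.sign (iteratedDeriv p S.α z.2) = ε}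

/-- The set of all orders of zeroes. -/
def orders : Set ℕ := {p | (zeros S p).Nonempty}

/-- Condition (c): if `p ∈ 𝒫`, then `𝒫` contains no factor of `p` smaller than `p / 2`. -/
def ConditionC : Prop :=
  ∀ p ∈ orders S, ∀ q ∈ orders S, q ∣ p → ¬ ((q : ℝ) < (p : ℝ) / 2)

variable {S}

/-- `η` is given by the sum of `conj (f_n(x)) g_n(x) / |α⁽ᵖ⁾(x) N(x)|^{1/p}` over `(n, x) ∈ Z`;
for all `f` and `g` only finitely many terms are nonzero. -/
def IsZeroSum (p : ℕ) (Z : Set (ℤ × ℝ)) (η : AntilinearToDual S) : Prop :=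
  ∀ f g : testSpace S,
    (Function.support fun z : Z =>
      starRingEnd ℂ (comp S f z.1.1 z.1.2) * comp S g z.1.1 z.1.2).Finite ∧
    η f g = ∑ᶠ z : Z,
      starRingEnd ℂ (comp S f z.1.1 z.1.2) * comp S g z.1.1 z.1.2 /
        ((|iteratedDeriv p S.α z.1.2 * S.N z.1.2| ^ (1 / (p : ℝ)) : ℝ) : ℂ)

end RAQ

end

noncomputable section

namespace RAQ

/-! ### Hadamard's lemma and the normal form of a smooth function at a zero of finite order -/

/-- The weighted average of `φ` over the segment from `a` to `x`. -/
def segmentAverage (a : ℝ) (w φ : ℝ → ℝ) (x : ℝ) : ℝ :=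
  ∫ t in (0 : ℝ)..1, w t * φ (a + t * (x - a))

theorem hasDerivAt_segmentAverage (a : ℝ) {w φ : ℝ → ℝ} (hw : Continuous w)
    (hφ : ContDiff ℝ ∞ φ) (x : ℝ) :
    HasDerivAt (segmentAverage a w φ) (segmentAverage a (fun t => w t * t) (deriv φ) x) x := by
  have hφc : Continuous φ := hφ.continuous
  have hφ'c : Continuous (deriv φ) := hφ.continuous_deriv (by simp)
  obtain ⟨C, hC⟩ := (isCompact_Icc (a := (0 : ℝ)) (b := 1)).prod
    (isCompact_closedBall x 1) |>.exists_bound_of_continuousOn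
    (f := fun z : ℝ × ℝ => w z.1 * z.1 * deriv φ (a + z.1 * (z.2 - a)))
    (by fun_prop)
  refine (intervalIntegral.hasDerivAt_integral_of_dominated_loc_of_deriv_le
    (F := fun x t => w t * φ (a + t * (x - a)))
    (F' := fun x t => w t * t * deriv φ (a + t * (x - a))) (bound := fun _ => C)
    (Metric.closedBall_mem_nhds x one_pos) (.of_forall fun y => ?_) ?_ ?_ ?_ ?_ ?_).2
  · exact Continuous.aestronglyMeasurable (by fun_prop)
  · exact Continuous.intervalIntegrable (by fun_prop) _ _
  · exact Continuous.aestronglyMeasurable (by fun_prop)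
  · refine .of_forall fun t ht y hy => hC (t, y) ⟨?_, hy⟩
    rw [Set.uIoc_of_le zero_le_one] at ht
    exact ⟨ht.1.le, ht.2⟩
  · exact intervalIntegrable_const
  · refine .of_forall fun t _ y _ => ?_
    have h1 : HasDerivAt (fun y : ℝ => a + t * (y - a)) t y := by
      simpa using (((hasDerivAt_id y).sub_const a).const_mul t).const_add a
    have h2 := ((hφ.differentiable (by simp)).differentiableAt
      (x := a + t * (y - a))).hasDerivAt.comp y h1
    exact (h2.const_mul (w t)).congr_deriv (by ring)

theorem deriv_segmentAverage (a : ℝ) {w φ : ℝ → ℝ} (hw : Continuous w) (hφ : ContDiff ℝ ∞ φ) :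
    deriv (segmentAverage a w φ) = segmentAverage a (fun t => w t * t) (deriv φ) :=
  funext fun x => (hasDerivAt_segmentAverage a hw hφ x).deriv

theorem contDiff_segmentAverage (a : ℝ) {w φ : ℝ → ℝ} (hw : Continuous w)
    (hφ : ContDiff ℝ ∞ φ) : ContDiff ℝ ∞ (segmentAverage a w φ) := by
  rw [contDiff_infty]
  intro n
  induction n generalizing w φ with
  | zero =>
    exact contDiff_zero.mpr (continuous_iff_continuousAt.mpr fun x =>
      (hasDerivAt_segmentAverage a hw hφ x).continuousAt)
  | succ n ih =>
    rw [Nat.cast_add, Nat.cast_one, contDiff_succ_iff_deriv]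
    refine ⟨fun x => (hasDerivAt_segmentAverage a hw hφ x).differentiableAt, by simp, ?_⟩
    rw [deriv_segmentAverage a hw hφ]
    exact ih (hw.mul continuous_id) ((contDiff_infty_iff_deriv (𝕜 := ℝ)).mp hφ).2

theorem iteratedDeriv_segmentAverage (a : ℝ) (k : ℕ) {w φ : ℝ → ℝ} (hw : Continuous w)
    (hφ : ContDiff ℝ ∞ φ) :
    iteratedDeriv k (segmentAverage a w φ)
      = segmentAverage a (fun t => w t * t ^ k) (iteratedDeriv k φ) := by
  induction k generalizing w φ with
  | zero => simp
  | succ k ih =>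
    rw [iteratedDeriv_succ', deriv_segmentAverage a hw hφ,
      ih (w := fun t => w t * t) (hw.mul continuous_id)
        ((contDiff_infty_iff_deriv (𝕜 := ℝ)).mp hφ).2, iteratedDeriv_succ']
    congr 1
    funext t
    ring

/-- **Hadamard's lemma**, first order. -/
theorem eq_add_mul_segmentAverage {f : ℝ → ℝ} (hf : ContDiff ℝ ∞ f) (a x : ℝ) :
    f x = f a + (x - a) * segmentAverage a (fun _ => 1) (deriv f) x := by
  have hd : ∀ t : ℝ, HasDerivAt (fun t : ℝ => f (a + t * (x - a)))
      (deriv f (a + t * (x - a)) * (x - a)) t := by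
    intro t
    have h1 : HasDerivAt (fun t : ℝ => a + t * (x - a)) (x - a) t := by
      simpa using ((hasDerivAt_id t).mul_const (x - a)).const_add a
    exact ((hf.differentiable (by simp)).differentiableAt
      (x := a + t * (x - a))).hasDerivAt.comp t h1
  have hc : Continuous (deriv f) := hf.continuous_deriv (by simp)
  have h := intervalIntegral.integral_eq_sub_of_hasDerivAt (a := 0) (b := 1)
    (fun t _ => hd t) (Continuous.intervalIntegrable (by fun_prop) _ _)
  rw [intervalIntegral.integral_mul_const] at h
  simp only [segmentAverage, one_mul, zero_mul, add_zero, add_sub_cancel] at h ⊢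
  linarith

/-- A smooth function that vanishes to order `p` at `a` is `(x - a) ^ p` times a smooth function. -/
theorem exists_eq_pow_mul {f : ℝ → ℝ} (hf : ContDiff ℝ ∞ f) (a : ℝ) (p : ℕ)
    (h0 : ∀ k < p, iteratedDeriv k f a = 0) :
    ∃ G : ℝ → ℝ, ContDiff ℝ ∞ G ∧ (∀ x, f x = (x - a) ^ p * G x) ∧
      G a = iteratedDeriv p f a / (p.factorial : ℝ) := by
  induction p generalizing f with
  | zero => exact ⟨f, hf, by simp, by simp⟩
  | succ p ih =>
    have hf' : ContDiff ℝ ∞ (deriv f) := ((contDiff_infty_iff_deriv (𝕜 := ℝ)).mp hf).2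
    have hk : ∀ k, iteratedDeriv k (segmentAverage a (fun _ => 1) (deriv f)) a
        = iteratedDeriv (k + 1) f a / ((k : ℝ) + 1) := by
      intro k
      rw [iteratedDeriv_segmentAverage a k continuous_const hf', iteratedDeriv_succ']
      simp only [segmentAverage, sub_self, mul_zero, add_zero, one_mul]
      rw [intervalIntegral.integral_mul_const, integral_pow]
      simp
      ring
    obtain ⟨G, hG, hfG, hGa⟩ := ih (contDiff_segmentAverage a continuous_const hf')
      (fun k hkp => by rw [hk, h0 (k + 1) (by omega), zero_div])
    refine ⟨G, hG, fun x => ?_, ?_⟩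
    · have h00 : f a = 0 := by simpa using h0 0 (by omega)
      rw [eq_add_mul_segmentAverage hf a x, hfG, h00]
      ring
    · rw [hGa, hk, Nat.factorial_succ]
      push_cast
      rw [div_div]

/-- A local diffeomorphism of the line. -/
structure IsDiffeo (e : OpenPartialHomeomorph ℝ ℝ) : Prop where
  contDiffOn : ContDiffOn ℝ ∞ e e.source
  contDiffOn_symm : ContDiffOn ℝ ∞ e.symm e.target

theorem IsDiffeo.symm {e : OpenPartialHomeomorph ℝ ℝ} (he : IsDiffeo e) : IsDiffeo e.symm :=
  ⟨he.contDiffOn_symm, by simpa using he.contDiffOn⟩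

theorem IsDiffeo.trans {e e' : OpenPartialHomeomorph ℝ ℝ} (he : IsDiffeo e) (he' : IsDiffeo e') :
    IsDiffeo (e.trans e') := by
  constructor
  · rw [OpenPartialHomeomorph.coe_trans, OpenPartialHomeomorph.trans_source]
    exact he'.contDiffOn.comp (he.contDiffOn.mono Set.inter_subset_left) fun x hx => hx.2
  · rw [OpenPartialHomeomorph.coe_trans_symm, OpenPartialHomeomorph.trans_target]
    exact he.contDiffOn_symm.comp (he'.contDiffOn_symm.mono Set.inter_subset_left) fun x hx => hx.2

theorem isDiffeo_neg : IsDiffeo (Homeomorph.neg ℝ).toOpenPartialHomeomorph :=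
  ⟨contDiff_neg.contDiffOn, contDiff_neg.contDiffOn⟩

theorem IsDiffeo.hasDerivAt {e : OpenPartialHomeomorph ℝ ℝ} (he : IsDiffeo e) {x : ℝ}
    (hx : x ∈ e.source) : HasDerivAt e (deriv e x) x :=
  ((he.contDiffOn.differentiableOn (by simp)).differentiableAt
    (e.open_source.mem_nhds hx)).hasDerivAt

theorem IsDiffeo.deriv_symm_mul_deriv {e : OpenPartialHomeomorph ℝ ℝ} (he : IsDiffeo e) {x : ℝ}
    (hx : x ∈ e.source) : deriv e.symm (e x) * deriv e x = 1 := by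
  have h1 := (he.symm.hasDerivAt (x := e x) (e.map_source hx)).comp x (he.hasDerivAt hx)
  refine h1.unique ((hasDerivAt_id x).congr_of_eventuallyEq ?_)
  filter_upwards [e.open_source.mem_nhds hx] with y hy
  simp [e.left_inv hy]

theorem IsDiffeo.deriv_symm_ne_zero {e : OpenPartialHomeomorph ℝ ℝ} (he : IsDiffeo e) {y : ℝ}
    (hy : y ∈ e.target) : deriv e.symm y ≠ 0 := by
  have h := he.deriv_symm_mul_deriv (e.map_target hy)
  rw [e.right_inv hy] at h
  exact left_ne_zero_of_mul_eq_one h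

/-- Near a zero of order `p`, a smooth function is `± y ^ p` in a suitable coordinate `y`. -/
theorem exists_normalForm {f G : ℝ → ℝ} (hG : ContDiff ℝ ∞ G) {a : ℝ} {p : ℕ} (hp : 1 ≤ p)
    (hf : ∀ x, f x = (x - a) ^ p * G x) {σ : ℝ} (hσ : σ * σ = 1) (hσG : 0 < σ * G a)
    {V : Set ℝ} (hV : V ∈ nhds a) :
    ∃ e : OpenPartialHomeomorph ℝ ℝ, IsDiffeo e ∧ a ∈ e.source ∧ e a = 0 ∧ e.source ⊆ V ∧
      (∀ x ∈ e.source, 0 < deriv e x) ∧ deriv e a = (σ * G a) ^ (1 / (p : ℝ)) ∧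
      ∀ x ∈ e.source, f x = σ * e x ^ p := by
  let y : ℝ → ℝ := fun x => (x - a) * (σ * G x) ^ (1 / (p : ℝ))
  have hsm : ∀ x, 0 < σ * G x → ContDiffAt ℝ ∞ y x := fun x hx =>
    (contDiffAt_id.sub contDiffAt_const).mul
      ((contDiffAt_const.mul hG.contDiffAt).rpow_const_of_ne hx.ne')
  have hya : HasDerivAt y ((σ * G a) ^ (1 / (p : ℝ))) a := by
    have h1 : DifferentiableAt ℝ (fun x => (σ * G x) ^ (1 / (p : ℝ))) a :=
      ((contDiffAt_const.mul hG.contDiffAt).rpow_const_of_ne (n := ∞)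
        hσG.ne').differentiableAt (by simp)
    exact (((hasDerivAt_id a).sub_const a).mul h1.hasDerivAt).congr_deriv (by simp)
  have hpos : 0 < (σ * G a) ^ (1 / (p : ℝ)) := Real.rpow_pos_of_pos hσG _
  have hGpos : ∀ᶠ x in nhds a, 0 < σ * G x :=
    (continuous_const.mul hG.continuous).continuousAt.eventually_const_lt hσG
  have hdc : ContinuousAt (deriv y) a := by
    have h1 : ContDiffAt ℝ 1 y a := (hsm a hσG).of_le (by simp)
    exact (h1.derivWithin (m := 0) (by simp)).continuousAt
  have hdpos : ∀ᶠ x in nhds a, 0 < deriv y x :=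
    hdc.eventually_const_lt (by rwa [hya.deriv])
  obtain ⟨s, hs, hso, has⟩ := mem_nhds_iff.mp (Filter.inter_mem hV (hGpos.and hdpos))
  let e0 := (hsm a hσG).toOpenPartialHomeomorph y (hya.hasFDerivAt_equiv hpos.ne') (by simp)
  have he0 : (e0 : ℝ → ℝ) = y := rfl
  have ha0 : a ∈ e0.source := (hsm a hσG).mem_toOpenPartialHomeomorph_source
    (hya.hasFDerivAt_equiv hpos.ne') (by simp)
  have hsrc : (e0.restrOpen s hso).source ⊆ s := by
    rw [OpenPartialHomeomorph.restrOpen_source]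
    exact Set.inter_subset_right
  refine ⟨e0.restrOpen s hso, ⟨?_, ?_⟩, ?_, ?_, ?_, ?_, ?_, ?_⟩
  · intro x hx
    exact (hsm x (hs (hsrc hx)).2.1).contDiffWithinAt
  · intro u hu
    have hx := hs (hsrc ((e0.restrOpen s hso).map_target hu))
    refine (OpenPartialHomeomorph.contDiffAt_symm_deriv (e0.restrOpen s hso) hx.2.2.ne' hu
      ?_ (hsm _ hx.2.1)).contDiffWithinAt
    exact ((hsm _ hx.2.1).differentiableAt (by simp)).hasDerivAt
  · exact ⟨ha0, has⟩
  · simp [he0, y]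
  · exact fun x hx => (hs (hsrc hx)).1
  · exact fun x hx => (hs (hsrc hx)).2.2
  · exact hya.deriv
  · intro x hx
    have hx' := (hs (hsrc hx)).2.1
    have hp0 : (p : ℝ) ≠ 0 := by exact_mod_cast (by omega : p ≠ 0)
    simp only [OpenPartialHomeomorph.coe_restrOpen, he0, y]
    rw [mul_pow, ← Real.rpow_natCast ((σ * G x) ^ (1 / (p : ℝ))), ← Real.rpow_mul hx'.le,
      one_div_mul_cancel hp0, Real.rpow_one, hf]
    linear_combination (-(x - a) ^ p * G x) * hσ

/-! ### Uniqueness of the Fourier transform of a sum of image measures -/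

theorem integral_map_withDensity_ofReal {R g : ℝ → ℝ} (hR : Measurable R) (hg : Measurable g)
    {F : ℝ → ℂ} (hF : Measurable F) :
    ∫ r, F r ∂((volume.withDensity fun x => ENNReal.ofReal (g x)).map R)
      = ∫ x, F (R x) * ((max (g x) 0 : ℝ) : ℂ) := by
  rw [integral_map hR.aemeasurable hF.aestronglyMeasurable,
    integral_withDensity_eq_integral_toReal_smul hg.ennreal_ofReal (by simp)]
  refine integral_congr_ae (.of_forall fun x => ?_)
  simp only [ENNReal.toReal_ofReal', Complex.real_smul]
  ring

theorem sum_integral_comp_mul_eq_zero_real {ι : Type*} (s : Finset ι) {R h : ι → ℝ → ℝ}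
    (hR : ∀ i, Measurable (R i)) (hm : ∀ i, Measurable (h i)) (hi : ∀ i, Integrable (h i))
    (H : ∀ t : ℝ, ∑ i ∈ s, ∫ x, Complex.exp (Complex.I * ((R i x * t : ℝ) : ℂ)) * (h i x : ℂ) = 0)
    {F : ℝ → ℂ} (hF : Measurable F) (hFb : ∀ r, ‖F r‖ ≤ 1) :
    ∑ i ∈ s, ∫ x, F (R i x) * (h i x : ℂ) = 0 := by
  let μ : (ι → ℝ → ℝ) → Measure ℝ := fun g =>
    ∑ i ∈ s, (volume.withDensity fun x => ENNReal.ofReal (g i x)).map (R i)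
  have hfin : ∀ g : ι → ℝ → ℝ, (∀ i, Integrable (g i)) → ∀ i,
      IsFiniteMeasure ((volume.withDensity fun x => ENNReal.ofReal (g i x)).map (R i)) := by
    intro g hg i
    have := isFiniteMeasure_withDensity_ofReal (hg i).hasFiniteIntegral
    infer_instance
  have hint : ∀ g : ι → ℝ → ℝ, (∀ i, Measurable (g i)) → (∀ i, Integrable (g i)) →
      ∀ F : ℝ → ℂ, Measurable F → (∀ r, ‖F r‖ ≤ 1) →
      ∫ r, F r ∂(μ g) = ∑ i ∈ s, ∫ x, F (R i x) * ((max (g i x) 0 : ℝ) : ℂ) := by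
    intro g hgm hg F hF hFb
    have := hfin g hg
    rw [integral_finsetSum_measure fun i _ =>
      Integrable.of_bound hF.aestronglyMeasurable 1 (.of_forall hFb)]
    exact Finset.sum_congr rfl fun i _ => integral_map_withDensity_ofReal (hR i) (hgm i) hF
  have hsub : ∀ F : ℝ → ℂ, Measurable F → (∀ r, ‖F r‖ ≤ 1) →
      ∫ r, F r ∂(μ h) - ∫ r, F r ∂(μ fun i x => -h i x)
        = ∑ i ∈ s, ∫ x, F (R i x) * (h i x : ℂ) := by
    intro F hF hFb
    rw [hint h hm hi F hF hFb,
      hint (fun i x => -h i x) (fun i => (hm i).neg) (fun i => (hi i).neg) F hF hFb, ← Finset.sum_sub_distrib]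
    refine Finset.sum_congr rfl fun i _ => ?_
    have hb : ∀ g : ℝ → ℝ, Integrable g →
        Integrable fun x => F (R i x) * ((max (g x) 0 : ℝ) : ℂ) := fun g hg =>
      hg.pos_part.ofReal.bdd_mul (hF.comp (hR i)).aestronglyMeasurable
        (.of_forall fun x => hFb _)
    rw [← integral_sub (hb _ (hi i)) (hb (fun x => -h i x) (hi i).neg)]
    refine integral_congr_ae (.of_forall fun x => ?_)
    simp only
    rw [← mul_sub, ← Complex.ofReal_sub, max_zero_sub_max_neg_zero_eq_self]
  have hμ : ∀ g : ι → ℝ → ℝ, (∀ i, Integrable (g i)) → IsFiniteMeasure (μ g) := by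
    intro g hg
    have := hfin g hg
    infer_instance
  have := hμ h hi
  have := hμ (fun i x => -h i x) fun i => (hi i).neg
  have heq : μ h = μ fun i x => -h i x := by
    refine Measure.ext_of_charFun (funext fun t => ?_)
    rw [charFun_apply_real, charFun_apply_real, ← sub_eq_zero, hsub, ← H t]
    · refine Finset.sum_congr rfl fun i _ => integral_congr_ae (.of_forall fun x => ?_)
      simp only
      congr 2
      push_cast
      ring
    · fun_prop
    · intro r
      rw [← Complex.ofReal_mul, Complex.norm_exp_ofReal_mul_I]
  rw [← hsub F hF hFb, heq, sub_self]

/-- If the Fourier transform of a finite sum of complex image measures `R_i (h_i dx)` vanishes,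
then so does the sum. -/
theorem sum_setIntegral_preimage_eq_zero {ι : Type*} (s : Finset ι) {R : ι → ℝ → ℝ}
    {h : ι → ℝ → ℂ} (hR : ∀ i, Measurable (R i)) (hm : ∀ i, Measurable (h i))
    (hi : ∀ i, Integrable (h i))
    (H : ∀ t : ℝ, ∑ i ∈ s, ∫ x, Complex.exp (Complex.I * ((R i x * t : ℝ) : ℂ)) * h i x = 0)
    {B : Set ℝ} (hB : MeasurableSet B) : ∑ i ∈ s, ∫ x in R i ⁻¹' B, h i x = 0 := by
  have hexpi : ∀ (t : ℝ) (i : ι) (g : ℝ → ℂ), Integrable g →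
      Integrable fun x => Complex.exp (Complex.I * ((R i x * t : ℝ) : ℂ)) * g x := by
    intro t i g hg
    have := hR i
    refine hg.bdd_mul (c := 1) (Measurable.aestronglyMeasurable (by fun_prop))
      (.of_forall fun x => ?_)
    rw [mul_comm, Complex.norm_exp_ofReal_mul_I]
  have hconj : ∀ t : ℝ, ∑ i ∈ s, ∫ x, Complex.exp (Complex.I * ((R i x * t : ℝ) : ℂ)) *
      starRingEnd ℂ (h i x) = 0 := by
    intro t
    have h1 := congrArg (starRingEnd ℂ) (H (-t))
    rw [map_zero, map_sum] at h1
    rw [← h1]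
    refine Finset.sum_congr rfl fun i _ => ?_
    rw [← integral_conj]
    refine integral_congr_ae (.of_forall fun x => ?_)
    simp [← Complex.exp_conj]
  have hci : ∀ i, Integrable fun x => starRingEnd ℂ (h i x) := fun i =>
    (LinearIsometryEquiv.integrable_comp_iff (Complex.conjLIE)).mpr (hi i)
  have hlin : ∀ (c d : ℂ) (k : ι → ℝ → ℝ), (∀ i x, (k i x : ℂ) = c * h i x + d *
      starRingEnd ℂ (h i x)) → ∀ t : ℝ, ∑ i ∈ s, ∫ x, Complex.exp (Complex.I *
        ((R i x * t : ℝ) : ℂ)) * (k i x : ℂ) = 0 := by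
    intro c d k hk t
    have h2 : ∀ i, ∫ x, Complex.exp (Complex.I * ((R i x * t : ℝ) : ℂ)) * (k i x : ℂ)
        = c * (∫ x, Complex.exp (Complex.I * ((R i x * t : ℝ) : ℂ)) * h i x) +
          d * ∫ x, Complex.exp (Complex.I * ((R i x * t : ℝ) : ℂ)) * starRingEnd ℂ (h i x) := by
      intro i
      rw [← integral_const_mul, ← integral_const_mul, ← integral_add
        ((hexpi t i _ (hi i)).const_mul c) ((hexpi t i _ (hci i)).const_mul d)]
      refine integral_congr_ae (.of_forall fun x => ?_)
      simp only [hk]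
      ring
    simp_rw [h2]
    rw [Finset.sum_add_distrib, ← Finset.mul_sum, ← Finset.mul_sum, H t, hconj t]
    simp
  have hF : Measurable (B.indicator fun _ => (1 : ℂ)) := measurable_const.indicator hB
  have hFb : ∀ r, ‖B.indicator (fun _ => (1 : ℂ)) r‖ ≤ 1 := fun r => by
    by_cases hr : r ∈ B <;> simp [hr]
  have hre := sum_integral_comp_mul_eq_zero_real s hR
    (fun i => Complex.measurable_re.comp (hm i)) (fun i => (hi i).re)
    (hlin (1 / 2) (1 / 2) _ fun i x => by
      simp only [Function.comp_apply, Complex.re_eq_add_conj]; ring) hF hFb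
  have him := sum_integral_comp_mul_eq_zero_real s hR
    (fun i => Complex.measurable_im.comp (hm i)) (fun i => (hi i).im)
    (hlin (1 / (2 * Complex.I)) (-1 / (2 * Complex.I)) _ fun i x => by
      simp only [Function.comp_apply, Complex.im_eq_sub_conj]; ring) hF hFb
  have hfb : ∀ (i : ι) (g : ℝ → ℝ), Integrable g →
      Integrable fun x => B.indicator (fun _ => (1 : ℂ)) (R i x) * (g x : ℂ) := fun i g hg =>
    hg.ofReal.bdd_mul (hF.comp (hR i)).aestronglyMeasurable (.of_forall fun x => hFb _)
  have hsplit : ∀ i, ∫ x in R i ⁻¹' B, h i x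
      = (∫ x, B.indicator (fun _ => (1 : ℂ)) (R i x) * ((Complex.re ∘ h i) x : ℂ)) +
        Complex.I * ∫ x, B.indicator (fun _ => (1 : ℂ)) (R i x) * ((Complex.im ∘ h i) x : ℂ) := by
    intro i
    rw [← integral_const_mul, ← integral_add (hfb i (Complex.re ∘ h i) (hi i).re)
      ((hfb i (Complex.im ∘ h i) (hi i).im).const_mul _),
      ← integral_indicator (hR i hB)]
    refine integral_congr_ae (.of_forall fun x => ?_)
    by_cases hx : R i x ∈ B
    · have h3 := Complex.re_add_im (h i x)
      simp only [Set.indicator, Set.mem_preimage, hx, if_true, Function.comp_apply]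
      linear_combination -h3
    · simp [Set.indicator, hx]
  simp_rw [hsplit]
  rw [Finset.sum_add_distrib, ← Finset.mul_sum]
  linear_combination hre + Complex.I * him

/-! ### Coefficients of asymptotic expansions in powers of a small parameter -/

/-- `D` has a finite asymptotic expansion in real powers of `s → 0+`, up to an error `o(s ^ θ)`, in
which `s ^ θ` has the coefficient `c`. -/
def HasCoeff (θ : ℝ) (D : ℝ → ℂ) (c : ℂ) : Prop :=
  ∃ a : ℝ →₀ ℂ, a θ = c ∧
    (fun s : ℝ => D s - a.sum fun e b => b * ((s ^ e : ℝ) : ℂ)) =o[nhdsWithin 0 (Set.Ioi 0)]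
      fun s : ℝ => s ^ θ

theorem hasCoeff_zero (θ : ℝ) : HasCoeff θ 0 0 :=
  ⟨0, rfl, by simp⟩

theorem HasCoeff.add {θ : ℝ} {D D' : ℝ → ℂ} {c c' : ℂ} (h : HasCoeff θ D c)
    (h' : HasCoeff θ D' c') : HasCoeff θ (fun s => D s + D' s) (c + c') := by
  obtain ⟨a, ha, h⟩ := h
  obtain ⟨a', ha', h'⟩ := h'
  refine ⟨a + a', by simp [ha, ha'], (h.add h').congr_left fun s => ?_⟩
  rw [Finsupp.sum_add_index' (by simp) (by intros; ring)]
  ring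

theorem HasCoeff.congr {θ : ℝ} {D D' : ℝ → ℂ} {c : ℂ} (h : HasCoeff θ D c)
    (hD : D' =ᶠ[nhdsWithin 0 (Set.Ioi 0)] D) : HasCoeff θ D' c := by
  obtain ⟨a, ha, h⟩ := h
  exact ⟨a, ha, h.congr' (hD.mono fun s hs => by simp only [hs]) .rfl⟩

theorem HasCoeff.sum {ι : Type*} {θ : ℝ} (t : Finset ι) {D : ι → ℝ → ℂ} {c : ι → ℂ}
    (h : ∀ i ∈ t, HasCoeff θ (D i) (c i)) :
    HasCoeff θ (fun s => ∑ i ∈ t, D i s) (∑ i ∈ t, c i) := by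
  classical
  induction t using Finset.induction_on with
  | empty => exact hasCoeff_zero θ
  | insert i t hi ih =>
    simp_rw [Finset.sum_insert hi]
    exact (h i (by simp)).add (ih fun j hj => h j (by simp [hj]))

/-- The coefficient of `s ^ θ` in an expansion of zero vanishes. -/
theorem HasCoeff.eq_zero {θ : ℝ} {c : ℂ} (h : HasCoeff θ 0 c) : c = 0 := by
  obtain ⟨a, rfl, h⟩ := h
  by_contra hne
  have hmem : θ ∈ a.support := Finsupp.mem_support_iff.mpr hne
  set m := a.support.min' ⟨θ, hmem⟩ with hm
  have hmθ : m ≤ θ := a.support.min'_le θ hmem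
  have hmm : m ∈ a.support := a.support.min'_mem _
  have hpow : ∀ e : ℝ, 0 < e → Filter.Tendsto (fun s : ℝ => s ^ e)
      (nhdsWithin 0 (Set.Ioi 0)) (nhds 0) := fun e he => by
    have h1 := (Real.continuousAt_rpow_const 0 e (.inr he.le)).tendsto
    rw [Real.zero_rpow he.ne'] at h1
    exact h1.mono_left nhdsWithin_le_nhds
  have hlim1 : Filter.Tendsto (fun s : ℝ => (a.sum fun e b => b * ((s ^ (e - m) : ℝ) : ℂ)))
      (nhdsWithin 0 (Set.Ioi 0)) (nhds (a m)) := by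
    have : a m = ∑ e ∈ a.support, if e = m then a m else 0 := by
      rw [Finset.sum_ite_eq', if_pos hmm]
    rw [this]
    refine tendsto_finsetSum _ fun e he => ?_
    split_ifs with hem
    · subst hem
      simp
    · have hlt : m < e := lt_of_le_of_ne (a.support.min'_le e he) (Ne.symm hem)
      have h2 := (Complex.continuous_ofReal.tendsto 0).comp (hpow (e - m) (by linarith))
      simpa using h2.const_mul (a e)
  have hlim2 : Filter.Tendsto (fun s : ℝ => (a.sum fun e b => b * ((s ^ (e - m) : ℝ) : ℂ)))
      (nhdsWithin 0 (Set.Ioi 0)) (nhds 0) := by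
    have h3 : (fun s : ℝ => a.sum fun e b => b * ((s ^ (e - m) : ℝ) : ℂ))
        =o[nhdsWithin 0 (Set.Ioi 0)] fun s : ℝ => s ^ (θ - m) := by
      refine Asymptotics.IsLittleO.congr' (f₁ := fun s : ℝ => ((s ^ (-m) : ℝ) : ℂ) *
        -((0 : ℝ → ℂ) s - a.sum fun e b => b * ((s ^ e : ℝ) : ℂ)))
        (g₁ := fun s : ℝ => s ^ (-m) * s ^ θ) ?_ ?_ ?_
      · refine ((Asymptotics.isBigO_of_le _ fun s => ?_).mul_isLittleO h.neg_left)
        simp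
      · filter_upwards [self_mem_nhdsWithin] with s hs
        simp only [Pi.zero_apply, zero_sub, neg_neg, Finsupp.sum, Finset.mul_sum]
        refine Finset.sum_congr rfl fun e _ => ?_
        rw [sub_eq_neg_add, Real.rpow_add hs]
        push_cast
        ring
      · filter_upwards [self_mem_nhdsWithin] with s hs
        rw [← Real.rpow_add hs]
        ring_nf
    rcases hmθ.eq_or_lt with heq | hlt
    · rw [heq] at h3 ⊢
      simpa [Asymptotics.isLittleO_one_iff] using h3
    · exact h3.trans_tendsto (hpow _ (by linarith))
  exact Finsupp.mem_support_iff.mp hmm (tendsto_nhds_unique hlim1 hlim2)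

/-- An expansion in integer powers of `t` becomes an expansion in powers of `s = t ^ q`. -/
theorem HasCoeff.of_pow {q : ℕ} (hq : 1 ≤ q) {θ : ℝ} (hθ : θ ≤ 1) {φ : ℝ → ℂ} {b : ℕ → ℂ}
    (h : (fun t : ℝ => φ t - ∑ k ∈ Finset.range (q + 1), b k * ((t ^ k : ℝ) : ℂ))
      =o[nhdsWithin 0 (Set.Ioi 0)] fun t : ℝ => t ^ q) :
    HasCoeff θ (fun s => φ (s ^ (1 / (q : ℝ))))
      (∑ k ∈ Finset.range (q + 1), if (k : ℝ) / q = θ then b k else 0) := by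
  have hq0 : (0 : ℝ) < q := by exact_mod_cast hq
  refine ⟨∑ k ∈ Finset.range (q + 1), Finsupp.single ((k : ℝ) / q) (b k), ?_, ?_⟩
  · rw [Finsupp.finsetSum_apply]
    exact Finset.sum_congr rfl fun k _ => by rw [Finsupp.single_apply]
  · have htend : Filter.Tendsto (fun s : ℝ => s ^ (1 / (q : ℝ))) (nhdsWithin 0 (Set.Ioi 0))
        (nhdsWithin 0 (Set.Ioi 0)) := by
      refine tendsto_nhdsWithin_iff.mpr ⟨?_, ?_⟩
      · have h1 := (Real.continuousAt_rpow_const 0 (1 / (q : ℝ)) (.inr (by positivity))).tendsto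
        rw [Real.zero_rpow (by positivity)] at h1
        exact h1.mono_left nhdsWithin_le_nhds
      · filter_upwards [self_mem_nhdsWithin] with s hs
        exact Real.rpow_pos_of_pos hs _
    have h1 := h.comp_tendsto htend
    have h2 : (fun s : ℝ => s) =O[nhdsWithin 0 (Set.Ioi 0)] fun s : ℝ => s ^ θ := by
      refine Asymptotics.IsBigO.of_bound 1 ?_
      filter_upwards [self_mem_nhdsWithin,
        nhdsWithin_le_nhds (Iio_mem_nhds (zero_lt_one' ℝ))] with s hs hs1
      rw [Set.mem_Ioi] at hs
      rw [one_mul, Real.norm_of_nonneg hs.le, Real.norm_of_nonneg (Real.rpow_nonneg hs.le _)]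
      simpa using Real.rpow_le_rpow_of_exponent_ge hs (le_of_lt hs1) hθ
    refine Asymptotics.IsLittleO.trans_isBigO (h1.congr' ?_ ?_) h2
    · filter_upwards [self_mem_nhdsWithin] with s hs
      rw [← Finsupp.sum_finsetSum_index (by simp) (by intros; ring)]
      simp only [Function.comp_apply]
      congr 1
      refine Finset.sum_congr rfl fun k _ => ?_
      rw [Finsupp.sum_single_index (by simp), ← Real.rpow_natCast, ← Real.rpow_mul (le_of_lt hs)]
      congr 3
      ring
    · filter_upwards [self_mem_nhdsWithin] with s hs
      simp only [Function.comp_apply]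
      rw [← Real.rpow_natCast, ← Real.rpow_mul (le_of_lt hs), one_div_mul_cancel hq0.ne',
        Real.rpow_one]

/-- Taylor's theorem at a point of smoothness. -/
theorem exists_taylor_coeffs {φ : ℝ → ℂ} {n : ℕ} (hφ : ContDiffAt ℝ n φ 0) :
    ∃ b : ℕ → ℂ, b 0 = φ 0 ∧ b 1 = deriv φ 0 ∧
      (fun t : ℝ => φ t - ∑ k ∈ Finset.range (n + 1), b k * ((t ^ k : ℝ) : ℂ))
        =o[nhds 0] fun t : ℝ => t ^ n := by
  obtain ⟨u, hu, hφu⟩ := hφ.contDiffOn (m := n) le_rfl (by simp)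
  obtain ⟨ε, hε, hball⟩ := Metric.mem_nhds_iff.mp hu
  have h0 : (0 : ℝ) ∈ Metric.ball (0 : ℝ) ε := Metric.mem_ball_self hε
  have h := taylor_isLittleO (convex_ball (0 : ℝ) ε) h0 (hφu.mono hball)
  rw [Metric.isOpen_ball.nhdsWithin_eq h0] at h
  refine ⟨fun k => ((k.factorial : ℝ)⁻¹ : ℝ) • iteratedDerivWithin k φ (Metric.ball 0 ε) 0,
    by simp, ?_, ?_⟩
  · simp only [Nat.factorial_one, Nat.cast_one, inv_one, one_smul]
    rw [iteratedDerivWithin_one, derivWithin_of_isOpen Metric.isOpen_ball h0]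
  · refine h.congr (fun t => ?_) (fun t => by simp)
    rw [taylor_within_apply]
    congr 1
    refine Finset.sum_congr rfl fun k _ => ?_
    simp only [sub_zero, Complex.real_smul]
    push_cast
    ring

/-! ### The mass near a zero: local expansion -/

theorem pos_mul_pow_lt_iff {ς y t : ℝ} (hς : ς * ς = 1) {q : ℕ} (hq : 1 ≤ q) (hy : 0 < y)
    (ht : 0 < t) : (0 < ς * y ^ q ∧ ς * y ^ q < t ^ q) ↔ ς = 1 ∧ y < t := by
  rcases mul_self_eq_one_iff.mp hς with rfl | rfl
  · rw [one_mul, pow_lt_pow_iff_left₀ hy.le ht.le (by omega)]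
    exact ⟨fun h => ⟨rfl, h.2⟩, fun h => ⟨by positivity, h.2⟩⟩
  · have : 0 < y ^ q := by positivity
    constructor
    · rintro ⟨h, -⟩
      linarith
    · rintro ⟨h, -⟩
      norm_num at h

section LocalMass

variable {e : OpenPartialHomeomorph ℝ ℝ} {a δ : ℝ}

theorem strictMonoOn_symm (he : IsDiffeo e) (hpos : ∀ x ∈ e.source, 0 < deriv e x)
    (hδt : Set.Ioo (-δ) δ ⊆ e.target) : StrictMonoOn e.symm (Set.Ioo (-δ) δ) := by
  refine strictMonoOn_of_deriv_pos (convex_Ioo _ _) (e.continuousOn_symm.mono hδt) fun y hy => ?_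
  rw [interior_Ioo] at hy
  have h := he.deriv_symm_mul_deriv (e.map_target (hδt hy))
  rw [e.right_inv (hδt hy)] at h
  have h2 := hpos _ (e.map_target (hδt hy))
  by_contra hc
  nlinarith

theorem image_symm_Ioo (he : IsDiffeo e) (hpos : ∀ x ∈ e.source, 0 < deriv e x)
    (hδt : Set.Ioo (-δ) δ ⊆ e.target) {u v : ℝ} (hu : -δ < u) (huv : u ≤ v) (hv : v < δ) :
    e.symm '' Set.Ioo u v = Set.Ioo (e.symm u) (e.symm v) := by
  have hmono := strictMonoOn_symm he hpos hδt
  have hmem : ∀ y ∈ Set.Icc u v, y ∈ Set.Ioo (-δ) δ := fun y hy =>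
    ⟨hu.trans_le hy.1, hy.2.trans_lt hv⟩
  refine Set.Subset.antisymm ?_ ?_
  · rintro _ ⟨y, hy, rfl⟩
    exact ⟨hmono (hmem u ⟨le_rfl, huv⟩) (hmem y ⟨hy.1.le, hy.2.le⟩) hy.1,
      hmono (hmem y ⟨hy.1.le, hy.2.le⟩) (hmem v ⟨huv, le_rfl⟩) hy.2⟩
  · exact intermediate_value_Ioo huv
      ((e.continuousOn_symm.mono hδt).mono fun y hy => hmem y hy)

/-- The mass of `h` near a zero, on the set where `f = σ y ^ q` has the sign `τ` and is smaller
than `t ^ q`. -/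
theorem setIntegral_localMass (he : IsDiffeo e) (hpos : ∀ x ∈ e.source, 0 < deriv e x)
    (ha : a ∈ e.source) (hea : e a = 0) (hδt : Set.Ioo (-δ) δ ⊆ e.target)
    {f : ℝ → ℝ} {σ τ : ℝ} (hσ : σ * σ = 1) (hτ : τ * τ = 1) {q : ℕ} (hq : 1 ≤ q)
    (hf : ∀ x ∈ e.source, f x = σ * e x ^ q) {h : ℝ → ℂ} (hh : Continuous h)
    {t : ℝ} (ht : 0 < t) (htδ : t < δ) :
    ∫ x in e.symm '' Set.Ioo (-δ) δ ∩ {x | 0 < τ * f x ∧ τ * f x < t ^ q}, h x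
      = (if τ * σ = 1 then 1 else 0) * (∫ x in a..e.symm t, h x) -
        (if τ * σ * (-1) ^ q = 1 then 1 else 0) * ∫ x in a..e.symm (-t), h x := by
  have hX0 : e.symm 0 = a := by rw [← hea, e.left_inv ha]
  have hplus : e.symm '' Set.Ioo 0 t = Set.Ioo a (e.symm t) := by
    rw [image_symm_Ioo he hpos hδt (by linarith) ht.le htδ, hX0]
  have hminus : e.symm '' Set.Ioo (-t) 0 = Set.Ioo (e.symm (-t)) a := by
    rw [image_symm_Ioo he hpos hδt (by linarith) (by linarith) (by linarith), hX0]
  have hmono := strictMonoOn_symm he hpos hδt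
  have h0δ : (0 : ℝ) ∈ Set.Ioo (-δ) δ := ⟨by linarith, by linarith⟩
  have hale : a ≤ e.symm t := by
    rw [← hX0]
    exact (hmono h0δ ⟨by linarith, htδ⟩ ht).le
  have hale' : e.symm (-t) ≤ a := by
    rw [← hX0]
    exact (hmono ⟨by linarith, by linarith⟩ h0δ (by linarith)).le
  have hset : e.symm '' Set.Ioo (-δ) δ ∩ {x | 0 < τ * f x ∧ τ * f x < t ^ q}
      = (if τ * σ = 1 then Set.Ioo a (e.symm t) else ∅) ∪
        (if τ * σ * (-1) ^ q = 1 then Set.Ioo (e.symm (-t)) a else ∅) := by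
    have key : ∀ y ∈ Set.Ioo (-δ) δ, (0 < τ * f (e.symm y) ∧ τ * f (e.symm y) < t ^ q) ↔
        (τ * σ = 1 ∧ y ∈ Set.Ioo 0 t) ∨ (τ * σ * (-1) ^ q = 1 ∧ y ∈ Set.Ioo (-t) 0) := by
      intro y hy
      rw [hf _ (e.map_target (hδt hy)), e.right_inv (hδt hy), ← mul_assoc]
      rcases lt_trichotomy y 0 with hy0 | rfl | hy0
      · have h1 : τ * σ * y ^ q = τ * σ * (-1) ^ q * (-y) ^ q := by
          rw [mul_assoc _ _ ((-y) ^ q), ← mul_pow]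
          congr 2
          ring
        have h2 : τ * σ * (-1) ^ q * (τ * σ * (-1) ^ q) = 1 := by
          have : ((-1 : ℝ) ^ q) * (-1) ^ q = 1 := by rw [← mul_pow]; simp
          linear_combination τ ^ 2 * σ ^ 2 * this + τ ^ 2 * hσ + hτ
        rw [h1, pos_mul_pow_lt_iff h2 hq (by linarith) ht]
        constructor
        · exact fun h => .inr ⟨h.1, by linarith [h.2], hy0⟩
        · rintro (⟨_, h⟩ | h)
          · linarith [h.1]
          · exact ⟨h.1, by linarith [h.2.1]⟩
      · simp [zero_pow (by omega : q ≠ 0)]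
      · have h2 : τ * σ * (τ * σ) = 1 := by linear_combination τ ^ 2 * hσ + hτ
        rw [pos_mul_pow_lt_iff h2 hq hy0 ht]
        constructor
        · exact fun h => .inl ⟨h.1, hy0, h.2⟩
        · rintro (h | ⟨_, h⟩)
          · exact ⟨h.1, h.2.2⟩
          · linarith [h.2]
    have hsub : Set.Ioo 0 t ⊆ Set.Ioo (-δ) δ := Set.Ioo_subset_Ioo (by linarith) htδ.le
    have hsub' : Set.Ioo (-t) 0 ⊆ Set.Ioo (-δ) δ := Set.Ioo_subset_Ioo (by linarith) (by linarith)
    rw [← hplus, ← hminus]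
    ext x
    constructor
    · rintro ⟨⟨y, hy, rfl⟩, hx⟩
      rcases (key y hy).mp hx with ⟨hc, hy'⟩ | ⟨hc, hy'⟩
      · left
        rw [if_pos hc]
        exact ⟨y, hy', rfl⟩
      · right
        rw [if_pos hc]
        exact ⟨y, hy', rfl⟩
    · rintro (hx | hx)
      · split_ifs at hx with hc
        · obtain ⟨y, hy, rfl⟩ := hx
          exact ⟨⟨y, hsub hy, rfl⟩, (key y (hsub hy)).mpr (.inl ⟨hc, hy⟩)⟩
        · exact hx.elim
      · split_ifs at hx with hc
        · obtain ⟨y, hy, rfl⟩ := hx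
          exact ⟨⟨y, hsub' hy, rfl⟩, (key y (hsub' hy)).mpr (.inr ⟨hc, hy⟩)⟩
        · exact hx.elim
  have hintOn : ∀ u v : ℝ, IntegrableOn h (Set.Ioo u v) := fun u v =>
    (hh.integrableOn_Icc).mono_set Set.Ioo_subset_Icc_self
  have hite : ∀ (P : Prop) [Decidable P] (u v : ℝ),
      MeasurableSet (if P then Set.Ioo u v else ∅) ∧ IntegrableOn h (if P then Set.Ioo u v else ∅) ∧
      ∫ x in (if P then Set.Ioo u v else ∅), h x = (if P then 1 else 0) * ∫ x in Set.Ioo u v, h x := by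
    intro P _ u v
    split_ifs
    · exact ⟨measurableSet_Ioo, hintOn u v, by simp⟩
    · simp
  rw [hset, setIntegral_union ?_ (hite _ _ _).1 (hite _ _ _).2.1 (hite _ _ _).2.1,
    (hite _ _ _).2.2, (hite _ _ _).2.2, intervalIntegral.integral_symm (e.symm (-t)),
    intervalIntegral.integral_of_le hale, intervalIntegral.integral_of_le hale',
    integral_Ioc_eq_integral_Ioo, integral_Ioc_eq_integral_Ioo]
  · ring
  · refine Set.disjoint_left.mpr fun x hx hx' => ?_
    split_ifs at hx hx' <;> first | exact hx.elim | exact hx'.elim | exact lt_asymm hx.1 hx'.2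

/-- Expansion of the mass of `h` near a zero of order `q`, in powers of the size of `f`. -/
theorem hasCoeff_localMass (he : IsDiffeo e) (hpos : ∀ x ∈ e.source, 0 < deriv e x)
    (ha : a ∈ e.source) (hea : e a = 0) (hδ : 0 < δ) (hδt : Set.Ioo (-δ) δ ⊆ e.target)
    {f : ℝ → ℝ} {σ τ : ℝ} (hσ : σ * σ = 1) (hτ : τ * τ = 1) {q : ℕ} (hq : 1 ≤ q)
    (hf : ∀ x ∈ e.source, f x = σ * e x ^ q) {h : ℝ → ℂ} (hh : ContDiff ℝ ∞ h)
    {p : ℕ} (hp : 1 ≤ p) (hpq : p ∣ q → q = p ∨ q = 2 * p) :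
    HasCoeff (1 / (p : ℝ))
      (fun s => ∫ x in e.symm '' Set.Ioo (-δ) δ ∩ {x | 0 < τ * f x ∧ τ * f x < s}, h x)
      (if q = p then ((if τ * σ = 1 then 1 else 0) + (if τ * σ * (-1) ^ q = 1 then 1 else 0)) *
        (h a * (((deriv e a)⁻¹ : ℝ) : ℂ)) else 0) := by
  set u : ℂ := if τ * σ = 1 then 1 else 0 with hu
  set v : ℂ := if τ * σ * (-1) ^ q = 1 then 1 else 0 with hv
  have hp0 : (0 : ℝ) < p := by exact_mod_cast hp
  have hq0 : (0 : ℝ) < q := by exact_mod_cast hq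
  have h0δ : (0 : ℝ) ∈ Set.Ioo (-δ) δ := ⟨by linarith, by linarith⟩
  have hX0 : e.symm 0 = a := by rw [← hea, e.left_inv ha]
  have hQ : ∀ x, HasDerivAt (fun x => ∫ r in a..x, h r) (h x) x := fun x =>
    intervalIntegral.integral_hasDerivAt_right (hh.continuous.intervalIntegrable _ _)
      (hh.continuous.stronglyMeasurableAtFilter _ _) hh.continuous.continuousAt
  have hQs : ContDiff ℝ ∞ fun x => ∫ r in a..x, h r := by
    rw [contDiff_infty_iff_deriv]
    refine ⟨fun x => (hQ x).differentiableAt, ?_⟩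
    rwa [funext fun x => (hQ x).deriv]
  have hXs : ContDiffAt ℝ ∞ e.symm 0 :=
    he.contDiffOn_symm.contDiffAt (e.open_target.mem_nhds (hδt h0δ))
  have hΦs : ContDiffAt ℝ q (fun t => ∫ r in a..e.symm t, h r) 0 :=
    (hQs.contDiffAt.comp 0 hXs).of_le (by exact_mod_cast le_top)
  have hΦd : deriv (fun t => ∫ r in a..e.symm t, h r) 0 = h a * (((deriv e a)⁻¹ : ℝ) : ℂ) := by
    have h1 := he.symm.hasDerivAt (x := 0) (hδt h0δ)
    have h2 := (hQ (e.symm 0)).scomp 0 h1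
    have h3 : deriv e.symm 0 = (deriv e a)⁻¹ := by
      have h4 := he.deriv_symm_mul_deriv ha
      rw [hea] at h4
      exact eq_inv_of_mul_eq_one_left h4
    rw [hX0, h3] at h2
    refine Eq.trans h2.deriv ?_
    rw [Complex.real_smul]
    ring
  obtain ⟨b, -, hb1, hb⟩ := exists_taylor_coeffs hΦs
  have hneg : Filter.Tendsto (fun t : ℝ => -t) (nhds 0) (nhds 0) := by
    simpa using (continuous_neg (G := ℝ)).tendsto 0
  have hb' : (fun t : ℝ => (u * (∫ r in a..e.symm t, h r) - v * ∫ r in a..e.symm (-t), h r) -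
      ∑ k ∈ Finset.range (q + 1), ((u - v * (-1) ^ k) * b k) * ((t ^ k : ℝ) : ℂ))
      =o[nhdsWithin 0 (Set.Ioi 0)] fun t : ℝ => t ^ q := by
    have h1 := hb.const_mul_left u
    have h2 := ((hb.comp_tendsto hneg).trans_isBigO (k := fun t : ℝ => t ^ q)
      (Asymptotics.isBigO_of_le _ fun t => by simp)).const_mul_left v
    refine ((h1.sub h2).mono nhdsWithin_le_nhds).congr_left fun t => ?_
    have h3 : ∑ k ∈ Finset.range (q + 1), ((u - v * (-1) ^ k) * b k) * ((t ^ k : ℝ) : ℂ)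
        = u * ∑ k ∈ Finset.range (q + 1), b k * ((t ^ k : ℝ) : ℂ) -
          v * ∑ k ∈ Finset.range (q + 1), b k * (((-t) ^ k : ℝ) : ℂ) := by
      rw [Finset.mul_sum, Finset.mul_sum, ← Finset.sum_sub_distrib]
      refine Finset.sum_congr rfl fun k _ => ?_
      rw [neg_pow t]
      push_cast
      ring
    rw [h3]
    simp only [Function.comp_apply]
    ring
  have hθ : 1 / (p : ℝ) ≤ 1 := by
    rw [div_le_one hp0]
    exact_mod_cast hp
  have hmain := HasCoeff.of_pow hq hθ hb'
  have hiff : ∀ k : ℕ, (k : ℝ) / q = 1 / p ↔ k * p = q := by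
    intro k
    rw [div_eq_div_iff hq0.ne' hp0.ne', one_mul]
    exact_mod_cast Iff.rfl
  have hcoef : (∑ k ∈ Finset.range (q + 1), if (k : ℝ) / q = 1 / p then
      (u - v * (-1) ^ k) * b k else 0)
      = if q = p then (u + v) * (h a * (((deriv e a)⁻¹ : ℝ) : ℂ)) else 0 := by
    simp_rw [hiff]
    split_ifs with hqp
    · subst hqp
      rw [Finset.sum_eq_single 1]
      · rw [if_pos (one_mul q), hb1, hΦd]
        ring
      · intro k _ hk
        rw [if_neg fun hkq => hk (Nat.eq_of_mul_eq_mul_right hp (by rw [hkq, one_mul]))]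
      · intro hk
        exact absurd (Finset.mem_range.mpr (by omega)) hk
    · refine Finset.sum_eq_zero fun k _ => ?_
      split_ifs with hk
      · have hq2 : q = 2 * p := (hpq ⟨k, by rw [← hk, mul_comm]⟩).resolve_left hqp
        have hk2 : k = 2 := Nat.eq_of_mul_eq_mul_right hp (by rw [hk, hq2])
        have huv : u = v := by
          rw [hu, hv, hq2, pow_mul]
          norm_num
        rw [huv, hk2]
        ring
      · rfl
  rw [← hcoef]
  refine hmain.congr ?_
  filter_upwards [self_mem_nhdsWithin,
    nhdsWithin_le_nhds (Iio_mem_nhds (by positivity : 0 < δ ^ q))] with s hs hsδ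
  have hs0 : 0 < s := hs
  have ht : 0 < s ^ (1 / (q : ℝ)) := Real.rpow_pos_of_pos hs0 _
  have htq : (s ^ (1 / (q : ℝ))) ^ q = s := by
    rw [← Real.rpow_natCast, ← Real.rpow_mul hs0.le, one_div_mul_cancel hq0.ne', Real.rpow_one]
  have htδ : s ^ (1 / (q : ℝ)) < δ := by
    rw [← pow_lt_pow_iff_left₀ ht.le hδ.le (by omega : q ≠ 0), htq]
    exact hsδ
  have h5 := setIntegral_localMass he hpos ha hea hδt hσ hτ hq hf hh.continuous ht htδ
  rw [htq] at h5
  exact h5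

end LocalMass

/-- The expansion of the mass of `h` on `{0 < τ f < s}` is the sum of the expansions at the zeros
of `f` in the support of `h`. -/
theorem hasCoeff_mass {θ τ : ℝ} (hτ : τ * τ = 1) {f : ℝ → ℝ} (hf : Continuous f) {h : ℝ → ℂ}
    (hh : Continuous h) (hhc : HasCompactSupport h) (Z : Finset ℝ)
    (hZ : ∀ x ∈ tsupport h, f x = 0 → x ∈ Z) (c : ℝ → ℂ)
    (hloc : ∀ x ∈ Z, ∀ V ∈ nhds x, ∃ U ⊆ V, IsOpen U ∧ x ∈ U ∧
      HasCoeff θ (fun s => ∫ y in U ∩ {y | 0 < τ * f y ∧ τ * f y < s}, h y) (c x)) :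
    HasCoeff θ (fun s => ∫ y in {y | 0 < τ * f y ∧ τ * f y < s}, h y) (∑ x ∈ Z, c x) := by
  obtain ⟨V, hV, hVd⟩ := Z.finite_toSet.t2_separation
  choose! U hUV hUo hxU hU using fun x hx => hloc x hx (V x) ((hV x).2.mem_nhds (hV x).1)
  have hint : Integrable h := hh.integrable_of_hasCompactSupport hhc
  have hKc : IsCompact (tsupport h \ ⋃ x ∈ Z, U x) :=
    hhc.isCompact.diff (isOpen_biUnion fun x hx => hUo x hx)
  have hs0 : ∃ s₀ > 0, ∀ y ∈ tsupport h \ ⋃ x ∈ Z, U x, s₀ ≤ |f y| := by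
    rcases (tsupport h \ ⋃ x ∈ Z, U x).eq_empty_or_nonempty with hem | hne
    · exact ⟨1, one_pos, by simp [hem]⟩
    · obtain ⟨y, hy, hmin⟩ := hKc.exists_isMinOn hne hf.abs.continuousOn
      refine ⟨|f y|, abs_pos.mpr fun h0 => hy.2 ?_, fun z hz => hmin hz⟩
      have hyZ := hZ y hy.1 h0
      exact Set.mem_biUnion hyZ (hxU y hyZ)
  obtain ⟨s₀, hs₀, hs₀f⟩ := hs0
  refine (HasCoeff.sum Z hU).congr ?_
  filter_upwards [nhdsWithin_le_nhds (Iio_mem_nhds hs₀)] with s hs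
  have hmeas : MeasurableSet {y | 0 < τ * f y ∧ τ * f y < s} :=
    have hτf : Continuous fun y => τ * f y := continuous_const.mul hf
    ((isOpen_lt continuous_const hτf).inter (isOpen_lt hτf continuous_const)).measurableSet
  rw [← integral_biUnion_finset Z (fun x hx => (hUo x hx).measurableSet.inter hmeas)
    (fun x hx y hy hxy => ((hVd hx hy hxy).mono (hUV x hx) (hUV y hy)).mono
      Set.inter_subset_left Set.inter_subset_left)
    (fun x _ => hint.integrableOn)]
  refine setIntegral_eq_of_subset_of_forall_sdiff_eq_zero hmeas
    (Set.iUnion₂_subset fun x _ => Set.inter_subset_right) fun y hy => ?_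
  by_contra hne
  have hyK : y ∈ tsupport h \ ⋃ x ∈ Z, U x := by
    refine ⟨subset_tsupport h hne, fun hyU => hy.2 ?_⟩
    obtain ⟨x, hx, hyx⟩ := Set.mem_iUnion₂.mp hyU
    exact Set.mem_biUnion hx ⟨hyx, hy.1⟩
  have h1 := hs₀f y hyK
  have h2 : |f y| = τ * f y := by
    rw [← abs_of_pos hy.1.1, abs_mul, (by rcases mul_self_eq_one_iff.mp hτ with rfl | rfl <;> simp : |τ| = 1), one_mul]
  have h3 := hy.1.2
  rw [Set.mem_Iio] at hs
  linarith

variable (S : ScalingData)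

/-! ### Components of test states -/

theorem comp_contDiff (f : testSpace S) (n : ℤ) : ContDiff ℝ ∞ (comp S f n) :=
  (components S f n).2.1

theorem comp_hasCompactSupport (f : testSpace S) (n : ℤ) : HasCompactSupport (comp S f n) :=
  (components S f n).2.2

theorem comp_add (f g : testSpace S) (n : ℤ) (x : ℝ) :
    comp S (f + g) n x = comp S f n x + comp S g n x := by
  simp [comp]

theorem comp_smul (c : ℂ) (f : testSpace S) (n : ℤ) (x : ℝ) :
    comp S (c • f) n x = c * comp S f n x := by
  simp [comp]

theorem comp_eq_zero_of_notMem {f : testSpace S} {n : ℤ} (hn : n ∉ (components S f).support) :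
    comp S f n = 0 := by
  rw [comp, Finsupp.notMem_support_iff.mp hn]
  rfl

theorem coe_components_symm (F : ℤ →₀ testFunctions) :
    ((components S).symm F : Haux) = synth S F := rfl

theorem comp_components_symm (F : ℤ →₀ testFunctions) (n : ℤ) :
    comp S ((components S).symm F) n = (F n).1 := by
  simp [comp]

theorem comp_components_symm_single (m : ℤ) (ψ : testFunctions) (n : ℤ) (x : ℝ) :
    comp S ((components S).symm (Finsupp.single m ψ)) n x = if m = n then ψ.1 x else 0 := by
  rw [comp_components_symm, Finsupp.single_apply]
  split_ifs <;> rfl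

theorem inner_testSpace (f g : testSpace S) {s : Finset ℤ} (hs : (components S f).support ⊆ s) :
    inner ℂ (f : Haux) (g : Haux)
      = ∑ n ∈ s, ∫ x, starRingEnd ℂ (comp S f n x) * comp S g n x := by
  obtain ⟨F, rfl⟩ := (components S).symm.surjective f
  obtain ⟨G, rfl⟩ := (components S).symm.surjective g
  rw [LinearEquiv.apply_symm_apply] at hs
  rw [coe_components_symm, coe_components_symm]
  conv_lhs => rw [synth, Finsupp.lsum_apply, Finsupp.sum, sum_inner]
  simp_rw [comp_components_symm]
  refine Finset.sum_subset_zero_on_sdiff hs (fun n hn => ?_) fun n _ => inner_mode_synth S n _ G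
  rw [Finsupp.notMem_support_iff.mp (Finset.mem_sdiff.mp hn).2]
  simp

theorem comp_gaugeTest (t : ℝ) (f : testSpace S) (n : ℤ) (x : ℝ) :
    comp S (gaugeTest S t f) n x
      = Complex.exp (Complex.I * ((S.R n x * t : ℝ) : ℂ)) * comp S f n x := by
  obtain ⟨F, rfl⟩ := (components S).symm.surjective f
  induction F using Finsupp.induction_linear with
  | zero => simp [comp]
  | add F G hF hG => rw [map_add, map_add, comp_add, comp_add, hF, hG, mul_add]
  | single m ψ =>
    have h : gaugeTest S t ((components S).symm (Finsupp.single m ψ))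
        = (components S).symm (Finsupp.single m (phaseMul S t m ψ)) := by
      refine Subtype.ext ?_
      change gauge S t ((components S).symm (Finsupp.single m ψ) : Haux) = _
      rw [coe_components_symm, coe_components_symm]
      simp [synth, gauge_mode]
    rw [h, comp_components_symm_single, comp_components_symm_single]
    split_ifs with hmn
    · subst hmn
      rfl
    · simp

/-! ### Matrix elements of observables -/

variable {S}

theorem Observable.coe_act (A : Observable S) (f : testSpace S) :
    (A.act f : Haux) = A.op ⟨f, A.le_domain f.2⟩ := rfl

theorem Observable.coe_adjAct (A : Observable S) (f : testSpace S) :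
    (A.adjAct f : Haux) = A.op† ⟨f, A.le_adjoint_domain f.2⟩ := rfl

theorem Observable.inner_act (A : Observable S) (f g : testSpace S) :
    inner ℂ (A.act f : Haux) (g : Haux) = inner ℂ (f : Haux) (A.adjAct g : Haux) := by
  have h := LinearPMap.adjoint_isFormalAdjoint A.dense ⟨g, A.le_adjoint_domain g.2⟩
    ⟨f, A.le_domain f.2⟩
  rw [A.coe_act, A.coe_adjAct, ← inner_conj_symm, ← h, inner_conj_symm]

theorem Observable.act_gaugeTest (A : Observable S) (t : ℝ) (f : testSpace S) :
    A.act (gaugeTest S t f) = gaugeTest S t (A.act f) :=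
  Subtype.ext (A.commutes t f)

theorem Observable.sum_integral_exp_mul (A : Observable S) (f g : testSpace S) {s : Finset ℤ}
    (hs : (components S f).support ⊆ s) (hs' : (components S (A.act f)).support ⊆ s) (t : ℝ) :
    ∑ n ∈ s, ∫ x, Complex.exp (Complex.I * ((S.R n x * t : ℝ) : ℂ)) *
        (starRingEnd ℂ (comp S (A.act f) n x) * comp S g n x)
      = ∑ n ∈ s, ∫ x, Complex.exp (Complex.I * ((S.R n x * t : ℝ) : ℂ)) *
        (starRingEnd ℂ (comp S f n x) * comp S (A.adjAct g) n x) := by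
  have hsupp : ∀ (f : testSpace S), (components S f).support ⊆ s →
      (components S (gaugeTest S (-t) f)).support ⊆ s := by
    intro f hf n hn
    by_contra hns
    refine Finsupp.mem_support_iff.mp hn (Subtype.ext (funext fun x => ?_))
    change comp S (gaugeTest S (-t) f) n x = 0
    rw [comp_gaugeTest, comp_eq_zero_of_notMem S fun h => hns (hf h)]
    simp
  have hinner : ∀ (f g : testSpace S), (components S f).support ⊆ s →
      inner ℂ (gaugeTest S (-t) f : Haux) (g : Haux)
        = ∑ n ∈ s, ∫ x, Complex.exp (Complex.I * ((S.R n x * t : ℝ) : ℂ)) *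
          (starRingEnd ℂ (comp S f n x) * comp S g n x) := by
    intro f g hf
    rw [inner_testSpace S _ g (hsupp f hf)]
    refine Finset.sum_congr rfl fun n _ => integral_congr_ae (.of_forall fun x => ?_)
    simp only
    rw [comp_gaugeTest, map_mul, ← Complex.exp_conj, ← mul_assoc]
    simp
  rw [← hinner _ _ hs', ← hinner _ _ hs, ← A.act_gaugeTest, A.inner_act]

/-! ### Zeros -/

theorem R_eq_zero_iff {n : ℤ} {x : ℝ} : S.R n x = 0 ↔ S.α x = n := by
  rw [ScalingData.R, mul_eq_zero, or_iff_left (S.N_pos x).ne', sub_eq_zero, eq_comm]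

theorem ConditionB'.finite_inter (hb : ConditionB' S) {K : Set ℝ} (hK : IsCompact K) :
    (integerSet S ∩ K).Finite := by
  by_contra hinf
  obtain ⟨x, -, hx⟩ := Set.Infinite.exists_accPt_of_subset_isCompact hinf hK Set.inter_subset_right
  exact hb.2.2.1 x (hx.mono (Filter.principal_mono.mpr Set.inter_subset_left))

theorem ConditionB'.exists_hasOrder (hb : ConditionB' S) {x : ℝ} (hx : x ∈ integerSet S) :
    ∃ q, HasOrder S q x := by
  classical
  have h := hb.2.2.2 x hx
  refine ⟨Nat.find h, (Nat.find_spec h).1, fun k hk hkq => ?_, (Nat.find_spec h).2⟩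
  by_contra hne
  exact Nat.find_min h hkq ⟨hk, hne⟩

theorem HasOrder.unique {p q : ℕ} {x : ℝ} (hp : HasOrder S p x) (hq : HasOrder S q x) : p = q := by
  rcases lt_trichotomy p q with h | h | h
  · exact absurd (hq.2.1 p hp.1 h) hp.2.2
  · exact h
  · exact absurd (hp.2.1 q hq.1 h) hq.2.2

theorem mem_integerSet_of_R_eq_zero {n : ℤ} {x : ℝ} (h : S.R n x = 0) : x ∈ integerSet S :=
  ⟨n, R_eq_zero_iff.mp h⟩

/-- The sign of `R_n` on the right of a zero of order `p`. -/
def zeroSign (S : ScalingData) (p : ℕ) (x : ℝ) : ℝ := -(SignType.sign (iteratedDeriv p S.α x) : ℝ)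

theorem HasOrder.zeroSign_mul_self {p : ℕ} {x : ℝ} (hp : HasOrder S p x) :
    zeroSign S p x * zeroSign S p x = 1 := by
  rcases hp.2.2.lt_or_gt with h | h
  · simp [zeroSign, sign_neg h]
  · simp [zeroSign, sign_pos h]

/-- The coordinate in which `R_n` is a signed power near a zero. -/
theorem exists_chart {n : ℤ} {x : ℝ} (hx : S.R n x = 0) {p : ℕ} (hp : HasOrder S p x)
    {V : Set ℝ} (hV : V ∈ nhds x) :
    ∃ e : OpenPartialHomeomorph ℝ ℝ, IsDiffeo e ∧ x ∈ e.source ∧ e x = 0 ∧ e.source ⊆ V ∧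
      (∀ y ∈ e.source, 0 < deriv e y) ∧
      deriv e x = (|iteratedDeriv p S.α x * S.N x| / (p.factorial : ℝ)) ^ (1 / (p : ℝ)) ∧
      ∀ y ∈ e.source, S.R n y = zeroSign S p x * e y ^ p := by
  have hF : ContDiff ℝ ∞ fun y => (n : ℝ) - S.α y := contDiff_const.sub S.α_smooth
  have hder : ∀ k, 1 ≤ k → iteratedDeriv k (fun y => (n : ℝ) - S.α y) x
      = -iteratedDeriv k S.α x := by
    intro k hk
    rw [iteratedDeriv_const_sub hk, iteratedDeriv_neg]
  have h0 : ∀ k < p, iteratedDeriv k (fun y => (n : ℝ) - S.α y) x = 0 := by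
    intro k hk
    rcases Nat.eq_zero_or_pos k with rfl | hk0
    · simp [R_eq_zero_iff.mp hx]
    · rw [hder k hk0, hp.2.1 k hk0 hk, neg_zero]
  obtain ⟨G, hG, hFG, hGx⟩ := exists_eq_pow_mul hF x p h0
  rw [hder p hp.1] at hGx
  have hval : zeroSign S p x * (G x * S.N x)
      = |iteratedDeriv p S.α x * S.N x| / (p.factorial : ℝ) := by
    rw [hGx, abs_mul, abs_of_pos (S.N_pos x), zeroSign, ← sign_mul_self]
    ring
  have hpos : 0 < |iteratedDeriv p S.α x * S.N x| / (p.factorial : ℝ) := by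
    have := abs_pos.mpr (mul_ne_zero hp.2.2 (S.N_pos x).ne')
    positivity
  obtain ⟨e, he, hxe, hex, heV, hepos, hed, heR⟩ := exists_normalForm (f := S.R n)
    (G := fun y => G y * S.N y) (a := x) (p := p) (hG.mul S.N_smooth) hp.1
    (fun y => by rw [ScalingData.R, hFG, mul_assoc]) hp.zeroSign_mul_self
    (by rw [hval]; exact hpos) hV
  exact ⟨e, he, hxe, hex, heV, hepos, by rw [hed, hval], heR⟩

/-! ### Vanishing of the weighted sum over the zeros -/

/-- The weight `|α⁽ᵖ⁾(x) N(x)| ^ (1/p)` of a zero of order `p`. -/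
def weight (S : ScalingData) (p : ℕ) (x : ℝ) : ℝ :=
  |iteratedDeriv p S.α x * S.N x| ^ (1 / (p : ℝ))

theorem HasOrder.weight_pos {p : ℕ} {x : ℝ} (hp : HasOrder S p x) : 0 < weight S p x :=
  Real.rpow_pos_of_pos (abs_pos.mpr (mul_ne_zero hp.2.2 (S.N_pos x).ne')) _

/-- The number of sides of a zero of order `p` on which `R_n` has the sign `τ`. -/
def sideCount (S : ScalingData) (p : ℕ) (τ x : ℝ) : ℂ :=
  (if τ * zeroSign S p x = 1 then 1 else 0) + (if τ * zeroSign S p x * (-1) ^ p = 1 then 1 else 0)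

theorem hasCoeff_zero_mass (hc : ConditionC S) {p : ℕ} (hp : p ∈ orders S) {n : ℤ} {x : ℝ}
    (hx : S.R n x = 0) {q : ℕ} (hq : HasOrder S q x) {τ : ℝ} (hτ : τ * τ = 1) {h : ℝ → ℂ}
    (hh : ContDiff ℝ ∞ h) {V : Set ℝ} (hV : V ∈ nhds x) :
    ∃ U ⊆ V, IsOpen U ∧ x ∈ U ∧
      HasCoeff (1 / (p : ℝ)) (fun s => ∫ y in U ∩ {y | 0 < τ * S.R n y ∧ τ * S.R n y < s}, h y)
        (if q = p then sideCount S p τ x * ((((p.factorial : ℝ) ^ (1 / (p : ℝ)) : ℝ) : ℂ) *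
          (h x / (weight S p x : ℂ))) else 0) := by
  obtain ⟨e, he, hxe, hex, heV, hepos, hed, heR⟩ := exists_chart hx hq hV
  have h0 : (0 : ℝ) ∈ e.target := hex ▸ e.map_source hxe
  obtain ⟨δ, hδ, hball⟩ := Metric.isOpen_iff.mp e.open_target 0 h0
  rw [Real.ball_eq_Ioo, zero_sub, zero_add] at hball
  have hp1 : 1 ≤ p := by
    obtain ⟨z, hz⟩ := hp
    exact hz.2.1
  have hdvd : p ∣ q → q = p ∨ q = 2 * p := by
    rintro ⟨k, rfl⟩
    have h1 := hc (p * k) ⟨(n, x), hx, hq⟩ p hp ⟨k, rfl⟩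
    have h2 : p * k ≤ 2 * p := by
      by_contra hlt
      refine h1 ?_
      have : ((2 * p : ℕ) : ℝ) < ((p * k : ℕ) : ℝ) := by exact_mod_cast not_le.mp hlt
      push_cast at this ⊢
      linarith
    have hk0 : k ≠ 0 := by
      rintro rfl
      exact absurd hq.1 (by simp)
    have hk2 : k ≤ 2 := by
      by_contra hk
      have : p * 3 ≤ p * k := Nat.mul_le_mul_left p (by omega)
      omega
    rcases (by omega : k = 1 ∨ k = 2) with rfl | rfl
    · left; ring
    · right; ring
  refine ⟨e.symm '' Set.Ioo (-δ) δ, ?_, ?_, ⟨0, ⟨by linarith, hδ⟩, ?_⟩, ?_⟩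
  · rintro _ ⟨y, hy, rfl⟩
    exact heV (e.map_target (hball hy))
  · exact e.symm.isOpen_image_of_subset_source isOpen_Ioo hball
  · rw [← hex, e.left_inv hxe]
  · convert hasCoeff_localMass he hepos hxe hex hδ hball hq.zeroSign_mul_self hτ hq.1 heR hh hp1
      hdvd using 1
    by_cases hqp : q = p
    · subst hqp
      rw [if_pos rfl, if_pos rfl, hed, Real.div_rpow (abs_nonneg _) (by positivity), sideCount, weight]
      push_cast
      rw [inv_div]
      ring
    · rw [if_neg hqp, if_neg hqp]

theorem finsum_coe_eq_sum {ι M : Type*} [AddCommMonoid M] (Z : Set ι) (k : ι → M) (T : Finset ι)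
    (hT : ∀ z ∈ Z, k z ≠ 0 → z ∈ T) :
    ∑ᶠ z : Z, k z = ∑ z ∈ T, Z.indicator k z := by
  rw [finsum_set_coe_eq_finsum_mem, finsum_mem_def]
  refine finsum_eq_sum_of_support_subset _ fun z hz => ?_
  have hzZ : z ∈ Z := by
    by_contra hzZ
    exact hz (Set.indicator_of_notMem hzZ k)
  exact hT z hzZ fun h0 => hz (by rw [Set.indicator_of_mem hzZ, h0])

theorem finsum_zeros_eq_zero (hb : ConditionB' S) (hc : ConditionC S) {p : ℕ} (hp : p ∈ orders S)
    {Z : Set (ℤ × ℝ)} (hZ : Z ⊆ zeros S p) {τ : ℝ} (hτ : τ * τ = 1) {m : ℂ} (hm : m ≠ 0)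
    (hcount : ∀ z ∈ zeros S p, sideCount S p τ z.2 = Z.indicator (fun _ => m) z)
    {s : Finset ℤ} {h : ℤ → ℝ → ℂ} (hh : ∀ n, ContDiff ℝ ∞ (h n))
    (hhc : ∀ n, HasCompactSupport (h n)) (hhs : ∀ n ∉ s, h n = 0)
    (H : ∀ t : ℝ, ∑ n ∈ s, ∫ x, Complex.exp (Complex.I * ((S.R n x * t : ℝ) : ℂ)) * h n x = 0) :
    ∑ᶠ z : Z, h z.1.1 z.1.2 / (weight S p z.1.2 : ℂ) = 0 := by
  classical
  have hRc : ∀ n, Continuous (S.R n) := fun n =>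
    (continuous_const.sub S.α_smooth.continuous).mul S.N_smooth.continuous
  have hK : IsCompact (⋃ n ∈ s, tsupport (h n)) := s.isCompact_biUnion fun n _ => (hhc n).isCompact
  set T := (hb.finite_inter hK).toFinset with hT
  have hmemT : ∀ n ∈ s, ∀ x ∈ tsupport (h n), S.R n x = 0 → x ∈ T := by
    intro n hn x hx hR
    rw [hT, Set.Finite.mem_toFinset]
    exact ⟨mem_integerSet_of_R_eq_zero hR, Set.mem_biUnion hn hx⟩
  set M : ℂ := m * (((p.factorial : ℝ) ^ (1 / (p : ℝ)) : ℝ) : ℂ) with hM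
  have hM0 : M ≠ 0 := by
    refine mul_ne_zero hm (Complex.ofReal_ne_zero.mpr (Real.rpow_pos_of_pos ?_ _).ne')
    positivity
  have hsum : HasCoeff (1 / (p : ℝ))
      (fun r => ∑ n ∈ s, ∫ y in {y | 0 < τ * S.R n y ∧ τ * S.R n y < r}, h n y)
      (∑ n ∈ s, ∑ x ∈ T.filter fun x => S.R n x = 0,
        Z.indicator (fun z => M * (h z.1 z.2 / (weight S p z.2 : ℂ))) (n, x)) := by
    refine HasCoeff.sum s fun n hn => ?_
    refine hasCoeff_mass hτ (hRc n) (hh n).continuous (hhc n) _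
      (fun x hx hR => Finset.mem_filter.mpr ⟨hmemT n hn x hx hR, hR⟩) _ fun x hx V hV => ?_
    have hR := (Finset.mem_filter.mp hx).2
    obtain ⟨q, hq⟩ := hb.exists_hasOrder (mem_integerSet_of_R_eq_zero hR)
    obtain ⟨U, hUV, hUo, hxU, hU⟩ := hasCoeff_zero_mass hc hp hR hq hτ (hh n) hV
    refine ⟨U, hUV, hUo, hxU, ?_⟩
    convert hU using 1
    split_ifs with hqp
    · subst hqp
      rw [hcount (n, x) ⟨hR, hq⟩]
      by_cases hz : (n, x) ∈ Z
      · rw [Set.indicator_of_mem hz, Set.indicator_of_mem hz, hM]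
        ring
      · rw [Set.indicator_of_notMem hz, Set.indicator_of_notMem hz, zero_mul]
    · refine Set.indicator_of_notMem (fun hz => hqp ?_) _
      exact hq.unique (hZ hz).2
  have hzero : (fun r : ℝ => ∑ n ∈ s, ∫ y in {y | 0 < τ * S.R n y ∧ τ * S.R n y < r}, h n y)
      = 0 := by
    funext r
    exact sum_setIntegral_preimage_eq_zero s (fun n => (hRc n).measurable)
      (fun n => (hh n).continuous.measurable)
      (fun n => (hh n).continuous.integrable_of_hasCompactSupport (hhc n)) H
      (B := {r' | 0 < τ * r' ∧ τ * r' < r})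
      ((isOpen_lt continuous_const (continuous_const.mul continuous_id)).inter
        (isOpen_lt (continuous_const.mul continuous_id) continuous_const)).measurableSet
  rw [hzero] at hsum
  have hfin := hsum.eq_zero
  rw [finsum_coe_eq_sum Z (fun z => h z.1 z.2 / (weight S p z.2 : ℂ)) (s ×ˢ T), ← mul_right_inj' hM0,
    mul_zero, ← hfin, Finset.mul_sum, Finset.sum_product]
  · refine Finset.sum_congr rfl fun n _ => ?_
    rw [Finset.sum_filter]
    refine Finset.sum_congr rfl fun x _ => ?_
    by_cases hz : (n, x) ∈ Z
    · have hR : S.R n x = 0 := (hZ hz).1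
      rw [if_pos hR, Set.indicator_of_mem hz, Set.indicator_of_mem hz]
    · rw [Set.indicator_of_notMem hz, Set.indicator_of_notMem hz]
      simp
  · intro z hz hne
    have hne' : h z.1 z.2 ≠ 0 := fun h0 => hne (by simp [h0])
    have hs : z.1 ∈ s := by
      by_contra hzs
      exact hne' (by rw [hhs _ hzs]; rfl)
    exact Finset.mem_product.mpr ⟨hs, hmemT _ hs _ (subset_tsupport _ hne') (hZ hz).1⟩

/-! ### The rigging maps -/

theorem finite_zeros_comp_ne_zero (hb : ConditionB' S) (f : testSpace S) :
    {z : ℤ × ℝ | S.R z.1 z.2 = 0 ∧ comp S f z.1 z.2 ≠ 0}.Finite := by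
  have hK : IsCompact (⋃ n ∈ (components S f).support, tsupport (comp S f n)) :=
    (components S f).support.isCompact_biUnion fun n _ => (comp_hasCompactSupport S f n).isCompact
  refine (((components S f).support.finite_toSet).prod (hb.finite_inter hK)).subset ?_
  rintro ⟨n, x⟩ ⟨hR, hne⟩
  have hn : n ∈ (components S f).support := by
    by_contra hn
    exact hne (by rw [comp_eq_zero_of_notMem S hn]; rfl)
  exact ⟨hn, mem_integerSet_of_R_eq_zero hR, Set.mem_biUnion hn (subset_tsupport _ hne)⟩

theorem finite_support_zeros (hb : ConditionB' S) {p : ℕ} {Z : Set (ℤ × ℝ)} (hZ : Z ⊆ zeros S p)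
    (f : testSpace S) (k : ℤ × ℝ → ℂ) (hk : ∀ z ∈ Z, comp S f z.1 z.2 = 0 → k z = 0) :
    (Function.support fun z : Z => k z).Finite := by
  refine ((finite_zeros_comp_ne_zero hb f).preimage Subtype.val_injective.injOn).subset ?_
  intro z hz
  exact ⟨(hZ z.2).1, fun h0 => hz (hk z z.2 h0)⟩

/-- The sesquilinear form given by the weighted sum over a set of zeros of order `p`. -/
def zeroSumMap (hb : ConditionB' S) (p : ℕ) (Z : Set (ℤ × ℝ)) (hZ : Z ⊆ zeros S p) :
    AntilinearToDual S :=
  LinearMap.mk₂'ₛₗ (starRingEnd ℂ) (RingHom.id ℂ)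
    (fun f g => ∑ᶠ z : Z, starRingEnd ℂ (comp S f z.1.1 z.1.2) * comp S g z.1.1 z.1.2 /
      (weight S p z.1.2 : ℂ))
    (fun f f' g => by
      rw [← finsum_add_distrib
        (finite_support_zeros hb hZ g (fun z => starRingEnd ℂ (comp S f z.1 z.2) *
          comp S g z.1 z.2 / (weight S p z.2 : ℂ)) fun z _ h => by simp [h])
        (finite_support_zeros hb hZ g (fun z => starRingEnd ℂ (comp S f' z.1 z.2) *
          comp S g z.1 z.2 / (weight S p z.2 : ℂ)) fun z _ h => by simp [h])]
      refine finsum_congr fun z => ?_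
      rw [comp_add, map_add]
      ring)
    (fun c f g => by
      rw [smul_finsum]
      refine finsum_congr fun z => ?_
      rw [smul_eq_mul, comp_smul, map_mul]
      ring)
    (fun f g g' => by
      rw [← finsum_add_distrib
        (finite_support_zeros hb hZ f (fun z => starRingEnd ℂ (comp S f z.1 z.2) *
          comp S g z.1 z.2 / (weight S p z.2 : ℂ)) fun z _ h => by simp [h])
        (finite_support_zeros hb hZ f (fun z => starRingEnd ℂ (comp S f z.1 z.2) *
          comp S g' z.1 z.2 / (weight S p z.2 : ℂ)) fun z _ h => by simp [h])]
      refine finsum_congr fun z => ?_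
      rw [comp_add]
      ring)
    (fun c f g => by
      rw [smul_finsum]
      refine finsum_congr fun z => ?_
      rw [smul_eq_mul, comp_smul, RingHom.id_apply]
      ring)

theorem zeroSumMap_apply (hb : ConditionB' S) (p : ℕ) (Z : Set (ℤ × ℝ)) (hZ : Z ⊆ zeros S p)
    (f g : testSpace S) :
    zeroSumMap hb p Z hZ f g = ∑ᶠ z : Z, starRingEnd ℂ (comp S f z.1.1 z.1.2) *
      comp S g z.1.1 z.1.2 / (weight S p z.1.2 : ℂ) := rfl

theorem isZeroSum_zeroSumMap (hb : ConditionB' S) (p : ℕ) (Z : Set (ℤ × ℝ)) (hZ : Z ⊆ zeros S p) :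
    IsZeroSum p Z (zeroSumMap hb p Z hZ) := fun f g =>
  ⟨finite_support_zeros hb hZ f (fun z => starRingEnd ℂ (comp S f z.1 z.2) * comp S g z.1 z.2)
    fun z _ h => by simp [h], rfl⟩

theorem zeroSumMap_act (hb : ConditionB' S) (hc : ConditionC S) {p : ℕ} (hp : p ∈ orders S)
    {Z : Set (ℤ × ℝ)} (hZ : Z ⊆ zeros S p) {τ : ℝ} (hτ : τ * τ = 1) {m : ℂ} (hm : m ≠ 0)
    (hcount : ∀ z ∈ zeros S p, sideCount S p τ z.2 = Z.indicator (fun _ => m) z)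
    (A : Observable S) (f g : testSpace S) :
    zeroSumMap hb p Z hZ (A.act f) g = zeroSumMap hb p Z hZ f (A.adjAct g) := by
  classical
  set s := (components S f).support ∪ (components S (A.act f)).support with hs
  let k : testSpace S → testSpace S → ℤ → ℝ → ℂ := fun f g n x =>
    starRingEnd ℂ (comp S f n x) * comp S g n x
  have hk : ∀ f g n, ContDiff ℝ ∞ (k f g n) := fun f g n =>
    (Complex.conjCLE.contDiff.comp (comp_contDiff S f n)).mul (comp_contDiff S g n)
  have hkc : ∀ f g n, HasCompactSupport (k f g n) := fun f g n =>
    (comp_hasCompactSupport S g n).mul_left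
  have hki : ∀ f g n t, Integrable fun x =>
      Complex.exp (Complex.I * ((S.R n x * t : ℝ) : ℂ)) * k f g n x := by
    intro f g n t
    have h1 : Continuous fun x => Complex.exp (Complex.I * ((S.R n x * t : ℝ) : ℂ)) := by
      have := S.α_smooth.continuous
      have := S.N_smooth.continuous
      unfold ScalingData.R
      fun_prop
    exact (h1.mul (hk f g n).continuous).integrable_of_hasCompactSupport (hkc f g n).mul_left
  have hkz : ∀ f g, ∀ n ∉ (components S f).support, k f g n = 0 := by
    intro f g n hn
    funext x
    simp [k, comp_eq_zero_of_notMem S hn]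
  have h := finsum_zeros_eq_zero hb hc hp hZ hτ hm hcount (s := s)
    (h := fun n => k (A.act f) g n - k f (A.adjAct g) n)
    (fun n => (hk _ _ n).sub (hk _ _ n))
    (fun n => (hkc _ _ n).sub (hkc _ _ n))
    (fun n hn => by
      rw [hs, Finset.notMem_union] at hn
      rw [hkz _ _ n hn.2, hkz _ _ n hn.1, sub_zero])
    (fun t => by
      have h1 := A.sum_integral_exp_mul f g Finset.subset_union_left Finset.subset_union_right t
      rw [← sub_eq_zero, ← Finset.sum_sub_distrib] at h1
      rw [← h1]
      refine Finset.sum_congr rfl fun n _ => ?_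
      rw [← integral_sub (hki _ _ n t) (hki _ _ n t)]
      refine integral_congr_ae (.of_forall fun x => ?_)
      simp only [Pi.sub_apply, k]
      ring)
  rw [zeroSumMap_apply, zeroSumMap_apply, ← sub_eq_zero, ← finsum_sub_distrib
    (finite_support_zeros hb hZ g (fun z => starRingEnd ℂ (comp S (A.act f) z.1 z.2) *
      comp S g z.1 z.2 / (weight S p z.2 : ℂ)) fun z _ h => by simp [h])
    (finite_support_zeros hb hZ f (fun z => starRingEnd ℂ (comp S f z.1 z.2) *
      comp S (A.adjAct g) z.1 z.2 / (weight S p z.2 : ℂ)) fun z _ h => by simp [h]), ← h]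
  refine finsum_congr fun z => ?_
  simp only [Pi.sub_apply, k]
  ring

theorem isRiggingMap_zeroSumMap (hb : ConditionB' S) (hc : ConditionC S) {p : ℕ}
    (hp : p ∈ orders S) {Z : Set (ℤ × ℝ)} (hZ : Z ⊆ zeros S p) {τ : ℝ} (hτ : τ * τ = 1) {m : ℂ}
    (hm : m ≠ 0)
    (hcount : ∀ z ∈ zeros S p, sideCount S p τ z.2 = Z.indicator (fun _ => m) z) :
    IsRiggingMap (zeroSumMap hb p Z hZ) where
  real f g := by
    rw [zeroSumMap_apply, zeroSumMap_apply]
    refine Eq.trans ?_ ((starRingEnd ℂ).toAddMonoidHom.map_finsum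
      (finite_support_zeros hb hZ f (fun z => starRingEnd ℂ (comp S g z.1 z.2) *
        comp S f z.1 z.2 / (weight S p z.2 : ℂ)) fun z _ h => by simp [h])).symm
    refine finsum_congr fun z => ?_
    simp
    ring
  nonneg f := by
    refine ⟨∑ᶠ z : Z, ‖comp S f z.1.1 z.1.2‖ ^ 2 / weight S p z.1.2,
      finsum_nonneg fun z => div_nonneg (by positivity) (hZ z.2).2.weight_pos.le, ?_⟩
    have hfin : (Function.support fun z : Z => ‖comp S f z.1.1 z.1.2‖ ^ 2 /
        weight S p z.1.2).Finite := by
      refine (finite_support_zeros hb hZ f (fun z => comp S f z.1 z.2) fun z _ h => h).subset ?_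
      intro z hz h0
      exact hz (by simp [h0])
    rw [zeroSumMap_apply]
    refine Eq.trans ?_ (Complex.ofRealHom.toAddMonoidHom.map_finsum hfin).symm
    refine finsum_congr fun z => ?_
    simp [Complex.conj_mul']
  invariant t f := by
    refine LinearMap.ext fun g => ?_
    rw [LinearMap.dualMap_apply, zeroSumMap_apply, zeroSumMap_apply]
    refine finsum_congr fun z => ?_
    rw [comp_gaugeTest, (hZ z.2).1]
    simp
  intertwines := zeroSumMap_act hb hc hp hZ hτ hm hcount

/-! ### Observables from formally adjoint pairs on `Φ` -/

section FormalAdjoint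

variable {A B : testSpace S →ₗ[ℂ] testSpace S}

/-- The extension of an operator on `Φ` by zero on the orthogonal complement of `Φ`. -/
def extendByZero (A : testSpace S →ₗ[ℂ] testSpace S) : Haux →ₗ.[ℂ] Haux :=
  LinearPMap.sup ⟨testSpace S, (testSpace S).subtype ∘ₗ A⟩ ⟨(testSpace S)ᗮ, 0⟩
    (LinearPMap.sup_h_of_disjoint _ _ (Submodule.orthogonal_disjoint _))

theorem extendByZero_domain (A : testSpace S →ₗ[ℂ] testSpace S) :
    (extendByZero A).domain = testSpace S ⊔ (testSpace S)ᗮ := rfl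

theorem testSpace_le_extendByZero_domain (A : testSpace S →ₗ[ℂ] testSpace S) :
    testSpace S ≤ (extendByZero A).domain := by
  rw [extendByZero_domain]
  exact le_sup_left

theorem extendByZero_apply (A : testSpace S →ₗ[ℂ] testSpace S) (f : testSpace S)
    (k : (testSpace S)ᗮ) (x : (extendByZero A).domain) (hx : (f : Haux) + k = x) :
    extendByZero A x = A f := by
  have h := LinearPMap.sup_apply (f := ⟨testSpace S, (testSpace S).subtype ∘ₗ A⟩)
    (g := ⟨(testSpace S)ᗮ, 0⟩)
    (LinearPMap.sup_h_of_disjoint _ _ (Submodule.orthogonal_disjoint _)) f k x hx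
  exact h.trans (by simp)

theorem extendByZero_coe (A : testSpace S →ₗ[ℂ] testSpace S) (f : testSpace S)
    (hf : (f : Haux) ∈ (extendByZero A).domain) : extendByZero A ⟨f, hf⟩ = A f :=
  extendByZero_apply A f 0 _ (by simp)

theorem dense_extendByZero_domain (A : testSpace S →ₗ[ℂ] testSpace S) :
    Dense ((extendByZero A).domain : Set Haux) := by
  rw [Submodule.dense_iff_topologicalClosure_eq_top, Submodule.topologicalClosure_eq_top_iff,
    extendByZero_domain, ← Submodule.inf_orthogonal]
  exact Submodule.inf_orthogonal_eq_bot _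

theorem inner_extendByZero (hAB : ∀ f g : testSpace S,
      inner ℂ (A f : Haux) (g : Haux) = inner ℂ (f : Haux) (B g : Haux))
    (g : testSpace S) (x : (extendByZero A).domain) :
    inner ℂ (B g : Haux) (x : Haux) = inner ℂ (g : Haux) (extendByZero A x) := by
  obtain ⟨f, hf, k, hk, hx⟩ := Submodule.mem_sup.mp x.2
  rw [extendByZero_apply A ⟨f, hf⟩ ⟨k, hk⟩ x hx, ← hx, inner_add_right,
    (Submodule.mem_orthogonal _ _).mp hk _ (B g).2, add_zero, ← inner_conj_symm,
    ← hAB ⟨f, hf⟩ g, inner_conj_symm]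

/-- A formally adjoint pair of operators on `Φ`, the first commuting with the gauge group, defines
an observable. -/
def Observable.ofFormalAdjoint (hAB : ∀ f g : testSpace S,
      inner ℂ (A f : Haux) (g : Haux) = inner ℂ (f : Haux) (B g : Haux))
    (hA : ∀ t f, A (gaugeTest S t f) = gaugeTest S t (A f)) : Observable S where
  op := extendByZero A
  dense := dense_extendByZero_domain A
  le_domain := testSpace_le_extendByZero_domain A
  le_adjoint_domain := fun g hg => LinearPMap.mem_adjoint_domain_of_exists _
    ⟨B ⟨g, hg⟩, inner_extendByZero hAB ⟨g, hg⟩⟩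
  maps f := by
    rw [extendByZero_coe]
    exact (A f).2
  adjoint_maps g := by
    rw [LinearPMap.adjoint_apply_eq (dense_extendByZero_domain A) _ (inner_extendByZero hAB g)]
    exact (B g).2
  commutes t f := by
    rw [extendByZero_coe, extendByZero_coe, hA]
    rfl

theorem Observable.ofFormalAdjoint_adjAct (hAB : ∀ f g : testSpace S,
      inner ℂ (A f : Haux) (g : Haux) = inner ℂ (f : Haux) (B g : Haux))
    (hA : ∀ t f, A (gaugeTest S t f) = gaugeTest S t (A f)) :
    (Observable.ofFormalAdjoint hAB hA).adjAct = B :=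
  LinearMap.ext fun g => Subtype.ext
    (LinearPMap.adjoint_apply_eq (dense_extendByZero_domain A) _ (inner_extendByZero hAB g))

end FormalAdjoint

/-! ### Transport of test functions by local diffeomorphisms -/

/-- A smooth cut-off function with compact support in `U`. -/
structure IsCutoff (w : ℝ → ℝ) (U : Set ℝ) : Prop where
  contDiff : ContDiff ℝ ∞ w
  hasCompactSupport : HasCompactSupport w
  tsupport_subset : tsupport w ⊆ U

theorem contDiff_of_contDiffAt_tsupport {E : Type*} [NormedAddCommGroup E] [NormedSpace ℝ E]
    {k : ℝ → E} {K : Set ℝ} (hK : IsClosed K) (h0 : ∀ x ∉ K, k x = 0)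
    (h : ∀ x ∈ K, ContDiffAt ℝ ∞ k x) : ContDiff ℝ ∞ k := by
  refine contDiff_iff_contDiffAt.mpr fun x => ?_
  by_cases hx : x ∈ K
  · exact h x hx
  · refine contDiffAt_const (c := (0 : E)) |>.congr_of_eventuallyEq ?_
    filter_upwards [hK.isOpen_compl.mem_nhds hx] with y hy using h0 y hy

/-- The operator `ψ ↦ w · (ψ ∘ e)` on test functions. -/
def transport {e : OpenPartialHomeomorph ℝ ℝ} (he : IsDiffeo e) {w : ℝ → ℝ}
    (hw : IsCutoff w e.source) : testFunctions →ₗ[ℂ] testFunctions where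
  toFun ψ := ⟨fun x => (w x : ℂ) * ψ.1 (e x), by
    constructor
    · refine contDiff_of_contDiffAt_tsupport (isClosed_tsupport w)
        (fun x hx => by simp [image_eq_zero_of_notMem_tsupport hx]) fun x hx => ?_
      have h1 : ContDiffAt ℝ ∞ e x := he.contDiffOn.contDiffAt
        (e.open_source.mem_nhds (hw.tsupport_subset hx))
      exact (Complex.ofRealCLM.contDiff.comp hw.contDiff).contDiffAt.mul
        (ψ.2.1.contDiffAt.comp x h1)
    · exact (hw.hasCompactSupport.comp_left (g := fun r : ℝ => (r : ℂ)) (by simp)).mul_right⟩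
  map_add' ψ χ := Subtype.ext (funext fun x => by simp [mul_add])
  map_smul' c ψ := Subtype.ext (funext fun x => by simp [mul_left_comm])

theorem transport_apply {e : OpenPartialHomeomorph ℝ ℝ} (he : IsDiffeo e) {w : ℝ → ℝ}
    (hw : IsCutoff w e.source) (ψ : testFunctions) (x : ℝ) :
    (transport he hw ψ).1 x = (w x : ℂ) * ψ.1 (e x) := rfl

/-- The weight of the adjoint of the transport operator. -/
def adjointWeight (e : OpenPartialHomeomorph ℝ ℝ) (w : ℝ → ℝ) : ℝ → ℝ :=
  e.target.indicator fun u => w (e.symm u) * |deriv e.symm u|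

theorem isCutoff_adjointWeight {e : OpenPartialHomeomorph ℝ ℝ} (he : IsDiffeo e) {w : ℝ → ℝ}
    (hw : IsCutoff w e.source) : IsCutoff (adjointWeight e w) e.symm.source := by
  have hK : IsCompact (e '' tsupport w) :=
    hw.hasCompactSupport.isCompact.image_of_continuousOn (e.continuousOn.mono hw.tsupport_subset)
  have hKt : e '' tsupport w ⊆ e.target := by
    rintro _ ⟨x, hx, rfl⟩
    exact e.map_source (hw.tsupport_subset hx)
  have h0 : ∀ u ∉ e '' tsupport w, adjointWeight e w u = 0 := by
    intro u hu
    by_cases hut : u ∈ e.target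
    · have hx : e.symm u ∉ tsupport w := fun hx => hu ⟨_, hx, e.right_inv hut⟩
      rw [adjointWeight, Set.indicator_of_mem hut, image_eq_zero_of_notMem_tsupport hx, zero_mul]
    · exact Set.indicator_of_notMem hut _
  have hts : tsupport (adjointWeight e w) ⊆ e '' tsupport w :=
    closure_minimal (fun u hu => by_contra fun hu' => hu (h0 u hu')) hK.isClosed
  refine ⟨contDiff_of_contDiffAt_tsupport hK.isClosed h0 fun u hu => ?_,
    hK.of_isClosed_subset (isClosed_tsupport _) hts, hts.trans hKt⟩
  have hnhds := e.open_target.mem_nhds (hKt hu)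
  have h1 : ContDiffAt ℝ ∞ e.symm u := he.contDiffOn_symm.contDiffAt hnhds
  have h2 : ContDiffAt ℝ ∞ (deriv e.symm) u := by
    have : ContDiffOn ℝ ∞ (deriv e.symm) e.target :=
      ((contDiffOn_infty_iff_deriv_of_isOpen e.open_target).mp he.contDiffOn_symm).2
    exact this.contDiffAt hnhds
  have h3 : ContDiffAt ℝ ∞ (fun u => w (e.symm u) * |deriv e.symm u|) u :=
    (hw.contDiff.contDiffAt.comp u h1).mul
      (h2.abs (he.deriv_symm_ne_zero (hKt hu)))
  refine h3.congr_of_eventuallyEq ?_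
  filter_upwards [hnhds] with v hv
  exact Set.indicator_of_mem hv _

theorem integral_conj_mul_transport {e : OpenPartialHomeomorph ℝ ℝ} (he : IsDiffeo e) {w : ℝ → ℝ}
    (hw : IsCutoff w e.source) (φ ψ : testFunctions) :
    ∫ u, starRingEnd ℂ ((transport he.symm (isCutoff_adjointWeight he hw) φ).1 u) * ψ.1 u
      = ∫ x, starRingEnd ℂ (φ.1 x) * (transport he hw ψ).1 x := by
  have h1 : ∀ u ∉ e.target,
      starRingEnd ℂ ((transport he.symm (isCutoff_adjointWeight he hw) φ).1 u) * ψ.1 u = 0 := by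
    intro u hu
    rw [transport_apply, adjointWeight, Set.indicator_of_notMem hu]
    simp
  have h2 : ∀ x ∉ e.source, starRingEnd ℂ (φ.1 x) * (transport he hw ψ).1 x = 0 := by
    intro x hx
    rw [transport_apply, image_eq_zero_of_notMem_tsupport fun h => hx (hw.tsupport_subset h)]
    simp
  rw [← setIntegral_eq_integral_of_forall_compl_eq_zero h1,
    ← setIntegral_eq_integral_of_forall_compl_eq_zero h2,
    ← e.symm_image_target_eq_source, integral_image_eq_integral_abs_deriv_smul
      e.open_target.measurableSet
      (fun u hu => (he.symm.hasDerivAt (x := u) hu).hasDerivWithinAt) e.symm.injOn]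
  refine setIntegral_congr_fun e.open_target.measurableSet fun u hu => ?_
  simp only [transport_apply, adjointWeight]
  rw [Set.indicator_of_mem hu, e.right_inv hu, Complex.real_smul]
  simp
  ring

/-! ### Observables that move one zero to another -/

theorem testSpace_ext {f g : testSpace S} (h : ∀ n x, comp S f n x = comp S g n x) : f = g :=
  (components S).injective (Finsupp.ext fun n => Subtype.ext (funext fun x => h n x))

/-- The operator on `Φ` that applies `T` to the component `n` and puts the result into the
component `m`. -/
def moveMode (S : ScalingData) (n m : ℤ) (T : testFunctions →ₗ[ℂ] testFunctions) :
    testSpace S →ₗ[ℂ] testSpace S :=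
  (components S).symm.toLinearMap ∘ₗ Finsupp.lsingle m ∘ₗ T ∘ₗ Finsupp.lapply n ∘ₗ
    (components S).toLinearMap

theorem comp_moveMode (n m : ℤ) (T : testFunctions →ₗ[ℂ] testFunctions) (f : testSpace S) (k : ℤ)
    (x : ℝ) : comp S (moveMode S n m T f) k x = if m = k then (T (components S f n)).1 x else 0 :=
  comp_components_symm_single S m (T (components S f n)) k x

/-- A local diffeomorphism `e` with `R_m ∘ e = R_n` gives an observable whose adjoint sends `g` to
the state with the single component `w · (g_m ∘ e)`, at `n`. -/
theorem exists_observable {e : OpenPartialHomeomorph ℝ ℝ} (he : IsDiffeo e) {w : ℝ → ℝ}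
    (hw : IsCutoff w e.source) {n m : ℤ} (hR : ∀ x ∈ e.source, S.R m (e x) = S.R n x) :
    ∃ A : Observable S, ∀ (g : testSpace S) (k : ℤ) (x : ℝ),
      comp S (A.adjAct g) k x = if n = k then (w x : ℂ) * comp S g m (e x) else 0 := by
  classical
  have hAB : ∀ f g : testSpace S,
      inner ℂ (moveMode S n m (transport he.symm (isCutoff_adjointWeight he hw)) f : Haux) (g : Haux)
        = inner ℂ (f : Haux) (moveMode S m n (transport he hw) g : Haux) := by
    intro f g
    set A := moveMode S n m (transport he.symm (isCutoff_adjointWeight he hw)) with hA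
    let s : Finset ℤ := (components S f).support ∪ (components S (A f)).support ∪ {n, m}
    have hs1 : (components S f).support ⊆ s := fun k hk => by simp only [s, Finset.mem_union]; tauto
    have hs2 : (components S (A f)).support ⊆ s := fun k hk => by
      simp only [s, Finset.mem_union]; tauto
    rw [inner_testSpace S _ g hs2, inner_testSpace S f _ hs1, Finset.sum_eq_single m,
      Finset.sum_eq_single n]
    · simp_rw [hA, comp_moveMode, if_true]
      exact integral_conj_mul_transport he hw (components S f n) (components S g m)
    · intro k _ hk
      simp [comp_moveMode, hk.symm]
    · exact fun h => absurd (by simp [s]) h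
    · intro k _ hk
      simp [hA, comp_moveMode, hk.symm]
    · exact fun h => absurd (by simp [s]) h
  refine ⟨Observable.ofFormalAdjoint hAB fun t f => testSpace_ext fun k u => ?_, fun g k x => ?_⟩
  · rw [comp_gaugeTest, comp_moveMode, comp_moveMode]
    split_ifs with hk
    · subst hk
      rw [transport_apply, transport_apply]
      change _ * comp S (gaugeTest S t f) n (e.symm u) = _ * (_ * comp S f n (e.symm u))
      rw [comp_gaugeTest]
      by_cases hu : u ∈ e.target
      · have h := hR _ (e.map_target hu)
        rw [e.right_inv hu] at h
        rw [h]
        ring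
      · rw [adjointWeight, Set.indicator_of_notMem hu]
        simp
    · simp
  · rw [Observable.ofFormalAdjoint_adjAct, comp_moveMode]
    rfl

/-- Zeros of the same order, of the same sign if the order is even, are related by a local
diffeomorphism that intertwines the functions `R_n`. -/
theorem exists_intertwining_diffeo {p : ℕ} {z z' : ℤ × ℝ} (hz : z ∈ zeros S p)
    (hz' : z' ∈ zeros S p) (hsign : Odd p ∨ zeroSign S p z.2 = zeroSign S p z'.2)
    {V : Set ℝ} (hV : V ∈ nhds z.2) :
    ∃ e : OpenPartialHomeomorph ℝ ℝ, IsDiffeo e ∧ z.2 ∈ e.source ∧ e z.2 = z'.2 ∧ e.source ⊆ V ∧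
      ∀ y ∈ e.source, S.R z'.1 (e y) = S.R z.1 y := by
  obtain ⟨e, he, hxe, hex, heV, -, -, heR⟩ := exists_chart hz.1 hz.2 hV
  obtain ⟨e', he', hxe', hex', -, -, -, heR'⟩ := exists_chart hz'.1 hz'.2 Filter.univ_mem
  have h0 : (0 : ℝ) ∈ e'.target := hex' ▸ e'.map_source hxe'
  have hs0 : e'.symm 0 = z'.2 := by rw [← hex', e'.left_inv hxe']
  by_cases hs : zeroSign S p z.2 = zeroSign S p z'.2
  · refine ⟨e.trans e'.symm, he.trans he'.symm, ⟨hxe, ?_⟩, ?_, fun y hy => heV hy.1, ?_⟩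
    · simpa [hex] using h0
    · simpa [hex] using hs0
    · intro y hy
      have hy2 : e y ∈ e'.target := hy.2
      rw [OpenPartialHomeomorph.trans_apply, heR' _ (e'.map_target hy2), e'.right_inv hy2,
        heR y hy.1, hs]
  · have hodd := hsign.resolve_right hs
    have hneg : zeroSign S p z'.2 = -zeroSign S p z.2 := by
      rcases mul_self_eq_mul_self_iff.mp
        (hz.2.zeroSign_mul_self.trans hz'.2.zeroSign_mul_self.symm) with h | h
      · exact absurd h hs
      · linarith
    let e₁ := e.trans (Homeomorph.neg ℝ).toOpenPartialHomeomorph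
    have he₁ : ∀ y, e₁ y = -e y := fun y => rfl
    have he₁s : e₁.source ⊆ e.source := fun y hy => hy.1
    refine ⟨e₁.trans e'.symm, (he.trans isDiffeo_neg).trans he'.symm,
      ⟨⟨hxe, Set.mem_univ _⟩, ?_⟩, ?_, fun y hy => heV (he₁s hy.1), ?_⟩
    · simpa [he₁, hex] using h0
    · simpa [he₁, hex] using hs0
    · intro y hy
      have hy2 : e₁ y ∈ e'.target := hy.2
      rw [OpenPartialHomeomorph.trans_apply, heR' _ (e'.map_target hy2), e'.right_inv hy2,
        heR y (he₁s hy.1), hneg, he₁, hodd.neg_pow]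
      ring

/-! ### Irreducibility -/

theorem ConditionB'.exists_nhds (hb : ConditionB' S) (x : ℝ) :
    ∃ V ∈ nhds x, ∀ y ∈ V, y ∈ integerSet S → y = x := by
  have h := hb.2.2.1 x
  rw [accPt_iff_frequently_nhdsNE, Filter.not_frequently, eventually_nhdsWithin_iff] at h
  exact ⟨_, h, fun y hy hyi => by_contra fun hne => hy hne hyi⟩

/-- The evaluation functional `g ↦ g_n(x)` at `z = (n, x)`. -/
def evalAt (S : ScalingData) (z : ℤ × ℝ) : Module.Dual ℂ (testSpace S) where
  toFun g := comp S g z.1 z.2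
  map_add' f g := comp_add S f g z.1 z.2
  map_smul' c f := comp_smul S c f z.1 z.2

theorem evalAt_apply (z : ℤ × ℝ) (g : testSpace S) : evalAt S z g = comp S g z.1 z.2 := rfl

theorem zeroSumMap_eq_sum (hb : ConditionB' S) {p : ℕ} {Z : Set (ℤ × ℝ)} (hZ : Z ⊆ zeros S p)
    (f : testSpace S) :
    ∃ T : Finset (ℤ × ℝ), zeroSumMap hb p Z hZ f = ∑ z ∈ T,
      Z.indicator (fun z => (starRingEnd ℂ (comp S f z.1 z.2) / (weight S p z.2 : ℂ)) •
        evalAt S z) z := by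
  refine ⟨(finite_zeros_comp_ne_zero hb f).toFinset, LinearMap.ext fun g => ?_⟩
  rw [zeroSumMap_apply, finsum_coe_eq_sum Z (fun z => starRingEnd ℂ (comp S f z.1 z.2) *
    comp S g z.1 z.2 / (weight S p z.2 : ℂ)) (finite_zeros_comp_ne_zero hb f).toFinset,
    LinearMap.sum_apply]
  · refine Finset.sum_congr rfl fun z _ => ?_
    by_cases hz : z ∈ Z
    · rw [Set.indicator_of_mem hz, Set.indicator_of_mem hz, LinearMap.smul_apply, evalAt_apply,
        smul_eq_mul]
      ring
    · rw [Set.indicator_of_notMem hz, Set.indicator_of_notMem hz]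
      rfl
  · intro z hz hne
    rw [Set.Finite.mem_toFinset]
    exact ⟨(hZ hz).1, fun h0 => hne (by simp [h0])⟩

theorem zeroSumMap_apply_eq_single (hb : ConditionB' S) {p : ℕ} {Z : Set (ℤ × ℝ)}
    (hZ : Z ⊆ zeros S p) {z : ℤ × ℝ} (hz : z ∈ Z) (f g : testSpace S)
    (hg : ∀ z' ∈ Z, comp S g z'.1 z'.2 ≠ 0 → z' = z) :
    zeroSumMap hb p Z hZ f g
      = starRingEnd ℂ (comp S f z.1 z.2) * comp S g z.1 z.2 / (weight S p z.2 : ℂ) := by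
  rw [zeroSumMap_apply]
  refine finsum_eq_single _ (⟨z, hz⟩ : Z) fun z' hne => ?_
  have h0 : comp S g z'.1.1 z'.1.2 = 0 := by
    by_contra h
    exact hne (Subtype.ext (hg z' z'.2 h))
  rw [h0, mul_zero, zero_div]

theorem exists_cutoff (x : ℝ) {V : Set ℝ} (hV : V ∈ nhds x) : ∃ w, IsCutoff w V ∧ w x = 1 := by
  obtain ⟨w, h1, h2, h3, -, h5⟩ := exists_contDiff_tsupport_subset (n := ⊤) hV
  exact ⟨w, ⟨h3, h2, h1⟩, h5⟩

theorem exists_zeroSumMap_ne_zero (hb : ConditionB' S) {p : ℕ} {Z : Set (ℤ × ℝ)}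
    (hZ : Z ⊆ zeros S p) (hne : Z.Nonempty) : ∃ f, zeroSumMap hb p Z hZ f ≠ 0 := by
  obtain ⟨z, hz⟩ := hne
  obtain ⟨V, hV, hVz⟩ := hb.exists_nhds z.2
  obtain ⟨w, hw, hwz⟩ := exists_cutoff z.2 hV
  let ψ : testFunctions := ⟨fun x => (w x : ℂ), Complex.ofRealCLM.contDiff.comp hw.contDiff,
    hw.hasCompactSupport.comp_left (g := fun r : ℝ => (r : ℂ)) (by simp)⟩
  refine ⟨(components S).symm (Finsupp.single z.1 ψ), fun h0 => ?_⟩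
  have h1 := zeroSumMap_apply_eq_single hb hZ hz ((components S).symm (Finsupp.single z.1 ψ))
    ((components S).symm (Finsupp.single z.1 ψ)) (fun z' hz' hne => by
      rw [comp_components_symm_single] at hne
      split_ifs at hne with hn
      · refine Prod.ext hn.symm (hVz _ (hw.tsupport_subset (subset_tsupport w fun h => hne ?_))
          (mem_integerSet_of_R_eq_zero (hZ hz').1))
        simp [ψ, h]
      · exact absurd rfl hne)
  rw [h0, comp_components_symm_single, if_pos rfl] at h1
  have hwt : (weight S p z.2 : ℂ) ≠ 0 := Complex.ofReal_ne_zero.mpr (hZ hz).2.weight_pos.ne'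
  simp [ψ, hwz] at h1
  exact hwt h1.symm

theorem actsIrreducibly_zeroSumMap (hb : ConditionB' S) {p : ℕ} {Z : Set (ℤ × ℝ)}
    (hZ : Z ⊆ zeros S p) (hne : Z.Nonempty)
    (hsign : ∀ z ∈ Z, ∀ z' ∈ Z, Odd p ∨ zeroSign S p z.2 = zeroSign S p z'.2)
    (hη : IsRiggingMap (zeroSumMap hb p Z hZ)) : ActsIrreducibly (zeroSumMap hb p Z hZ) where
  nonzero := by
    obtain ⟨f, hf⟩ := exists_zeroSumMap_ne_zero hb hZ hne
    exact fun h => hf ((Submodule.eq_bot_iff _).mp h _ ⟨f, rfl⟩)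
  stable := by
    rintro A _ ⟨f, rfl⟩
    exact ⟨A.act f, LinearMap.ext fun g => hη.intertwines A f g⟩
  irreducible := by
    intro W hW hinv
    refine or_iff_not_imp_left.mpr fun hbot => le_antisymm hW ?_
    obtain ⟨F, hF, hF0⟩ := (Submodule.ne_bot_iff W).mp hbot
    obtain ⟨f, rfl⟩ := hW hF
    obtain ⟨z, hz, hfz⟩ : ∃ z ∈ Z, comp S f z.1 z.2 ≠ 0 := by
      by_contra! hall
      refine hF0 (LinearMap.ext fun g => ?_)
      rw [zeroSumMap_apply]
      exact finsum_eq_zero_of_forall_eq_zero fun z => by simp [hall z z.2]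
    have heval : ∀ z' ∈ Z, evalAt S z' ∈ W := by
      intro z' hz'
      obtain ⟨V, hV, hVz⟩ := hb.exists_nhds z.2
      obtain ⟨e, he, hze, hez, heV, heR⟩ :=
        exists_intertwining_diffeo (hZ hz) (hZ hz') (hsign z hz z' hz') hV
      obtain ⟨w, hw, hwz⟩ := exists_cutoff z.2 (e.open_source.mem_nhds hze)
      obtain ⟨A, hA⟩ := exists_observable he hw heR
      set c : ℂ := starRingEnd ℂ (comp S f z.1 z.2) / (weight S p z.2 : ℂ) with hc
      have hc0 : c ≠ 0 := div_ne_zero (by simpa using hfz)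
        (Complex.ofReal_ne_zero.mpr (hZ hz).2.weight_pos.ne')
      have hAF : A.dualAct (zeroSumMap hb p Z hZ f) = c • evalAt S z' := by
        refine LinearMap.ext fun g => ?_
        change zeroSumMap hb p Z hZ f (A.adjAct g) = c * comp S g z'.1 z'.2
        rw [zeroSumMap_apply_eq_single hb hZ hz, hA, if_pos rfl, hwz, hez, hc]
        · push_cast
          ring
        · intro y hy hne
          rw [hA] at hne
          split_ifs at hne with hn
          · refine Prod.ext hn.symm (hVz _ (heV (hw.tsupport_subset
              (subset_tsupport w fun h => hne ?_))) (mem_integerSet_of_R_eq_zero (hZ hy).1))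
            simp [h]
          · exact absurd rfl hne
      have h := W.smul_mem c⁻¹ (hinv A _ hF)
      rwa [hAF, smul_smul, inv_mul_cancel₀ hc0, one_smul] at h
    rintro _ ⟨f', rfl⟩
    obtain ⟨T, hT⟩ := zeroSumMap_eq_sum hb hZ f'
    rw [hT]
    refine W.sum_mem fun z' _ => ?_
    by_cases hz' : z' ∈ Z
    · rw [Set.indicator_of_mem hz']
      exact W.smul_mem _ (heval z' hz')
    · rw [Set.indicator_of_notMem hz']
      exact W.zero_mem

theorem exists_riggingMap (hb : ConditionB' S) (hc : ConditionC S) {p : ℕ} {Z : Set (ℤ × ℝ)}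
    (hZ : Z ⊆ zeros S p) (hne : Z.Nonempty)
    (hsign : ∀ z ∈ Z, ∀ z' ∈ Z, Odd p ∨ zeroSign S p z.2 = zeroSign S p z'.2)
    {τ : ℝ} (hτ : τ * τ = 1) {m : ℂ} (hm : m ≠ 0)
    (hcount : ∀ z ∈ zeros S p, sideCount S p τ z.2 = Z.indicator (fun _ => m) z) :
    ∃ η : AntilinearToDual S, IsZeroSum p Z η ∧ IsRiggingMap η ∧ (∃ f, η f ≠ 0) ∧
      ActsIrreducibly η := by
  have hη := isRiggingMap_zeroSumMap hb hc (hne.mono hZ) hZ hτ hm hcount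
  exact ⟨zeroSumMap hb p Z hZ, isZeroSum_zeroSumMap hb p Z hZ, hη,
    exists_zeroSumMap_ne_zero hb hZ hne, actsIrreducibly_zeroSumMap hb hZ hne hsign hη⟩

theorem sideCount_of_odd {p : ℕ} (hodd : Odd p) {x : ℝ} (hp : HasOrder S p x) :
    sideCount S p 1 x = 1 := by
  rcases mul_self_eq_one_iff.mp hp.zeroSign_mul_self with h | h <;>
    norm_num [sideCount, h, hodd.neg_one_pow]

theorem sideCount_of_even {p : ℕ} (heven : Even p) {x : ℝ} {ε : SignType} (hε : ε ≠ 0) :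
    sideCount S p (-(ε : ℝ)) x
      = if SignType.sign (iteratedDeriv p S.α x) = ε then 2 else 0 := by
  rw [sideCount, heven.neg_one_pow, zeroSign]
  generalize SignType.sign (iteratedDeriv p S.α x) = s
  cases ε <;> cases s <;> first | exact absurd rfl hε | (norm_num [SignType.cast] <;> decide)

end RAQ

end

theorem theorem2 (S : RAQ.ScalingData) (ha : RAQ.ConditionA S) (hb : RAQ.ConditionB' S)
    (hc : RAQ.ConditionC S) :
    (∀ p ∈ RAQ.orders S, Odd p →
      ∃ η : RAQ.AntilinearToDual S, RAQ.IsZeroSum p (RAQ.zeros S p) η ∧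
        RAQ.IsRiggingMap η ∧ (∃ f, η f ≠ 0) ∧ RAQ.ActsIrreducibly η) ∧
    (∀ p ∈ RAQ.orders S, Even p → ∀ ε : SignType, ε ≠ 0 → (RAQ.signedZeros S p ε).Nonempty →
      ∃ η : RAQ.AntilinearToDual S, RAQ.IsZeroSum p (RAQ.signedZeros S p ε) η ∧
        RAQ.IsRiggingMap η ∧ (∃ f, η f ≠ 0) ∧ RAQ.ActsIrreducibly η) := by
  constructor
  · intro p hp hodd
    refine RAQ.exists_riggingMap hb hc subset_rfl hp (fun _ _ _ _ => .inl hodd)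
      (one_mul (1 : ℝ)) one_ne_zero fun z hz => ?_
    rw [RAQ.sideCount_of_odd hodd hz.2, Set.indicator_of_mem hz]
  · intro p hp heven ε hε hne
    refine RAQ.exists_riggingMap hb hc (fun z hz => hz.1) hne
      (fun z hz z' hz' => .inr (by rw [RAQ.zeroSign, RAQ.zeroSign, hz.2, hz'.2]))
      (τ := -(ε : ℝ)) (by cases ε <;> simp at hε ⊢) (m := 2) two_ne_zero fun z hz => ?_
    rw [RAQ.sideCount_of_even heven hε]
    split_ifs with h
    · rw [Set.indicator_of_mem (show z ∈ RAQ.signedZeros S p ε from ⟨hz, h⟩)]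
    · rw [Set.indicator_of_notMem (show z ∉ RAQ.signedZeros S p ε from fun h' => h h'.2)]
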